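/- Let $\Bbbk$ be a field, $S=\Bbbk[x_1,\dots,x_n]$, and let $I\subsetneq S$ be a Borel fixed (strongly stable) monomial ideal with minimal set of monomial generators $G(I)$: if $\mathsf m\in G(I)$, $x_i\mid \mathsf m$ and $j<i$, then $(x_j/x_i)\mathsf m\in I$. Let $d$ be such that $\deg \mathsf m\le d$ for all $\mathsf m\in G(I)$, and let $\widetilde S=\Bbbk[x_{i,j}\mid 1\le i\le n,\ 1\le j\le d]$. Write a monomial as $\mathsf m=\prod_{i=1}^e x_{\alpha_i}=\prod_{l} x_l^{c_l}$ with $\alpha_1\le\dots\le\alpha_e$, and put $\nu(\mathsf m)=\alpha_e$ and $\widetilde{\mathsf m}=\prod_{i=1}^e x_{\alpha_i,i}\in\widetilde S$ (for $e\le d$). *The complex $\widetilde P_\bullet$.* For a monomial $\mathsf m\in I$ let $g(\mathsf m)=\mathsf m_1$, where $\mathsf m=\mathsf m_1\mathsf m_2$ is the unique factorization such that $\mathsf m_1\in G(I)$ and every variable dividing $\mathsf m_1$ has index at most that of every variable dividing $\mathsf m_2$. For $\mathsf m\in G(I)$ and $i<\nu(\mathsf m)$ put $\mathsf m_{\langle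 i\rangle}=g\big((x_i/x_k)\mathsf m\big)$, where $k=\min\{l>i\mid x_l \text{ divides } \mathsf m\}$. A pair $(\widetilde F,\widetilde{\mathsf m})$ with $\mathsf m\in G(I)$ and $\widetilde F=\{(i_1,j_1),\dots,(i_q,j_q)\}$, $q\ge 0$, is admissible if $1\le i_1<\dots<i_q<\nu(\mathsf m)$ and $j_r=1+\sum_{l\le i_r}c_l$ for all $r$. Put $\widetilde F_r=\widetilde F\setminus\{(i_r,j_r)\}$ and $B(\widetilde F,\widetilde{\mathsf m})=\{r\mid (\widetilde F_r,\widetilde{\mathsf m}_{\langle i_r\rangle})\text{ is admissible}\}$, where $\widetilde{\mathsf m}_{\langle i\rangle}$ is the tilde of $\mathsf m_{\langle i\rangle}$. Let $\widetilde P_0=\widetilde S$, let $\widetilde P_{q+1}$ ($q\ge0$) be the free $\widetilde S$-module with basis the symbols $e(\widetilde F,\widetilde{\mathsf m})$ for the admissible pairs with $\#\widetilde F=q$, and let $$\partial e(\widetilde F,\widetilde{\mathsf m})=\sum_{r=1}^q(-1)^r x_{i_r,j_r}\,e(\widetilde F_r,\widetilde{\mathsf m})-\sum_{r\in B(\widetilde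 F,\widetilde{\mathsf m})}(-1)^r\,\frac{x_{i_r,j_r}\widetilde{\mathsf m}}{\widetilde{\mathsf m}_{\langle i_r\rangle}}\,e(\widetilde F_r,\widetilde{\mathsf m}_{\langle i_r\rangle})\quad(q\ge1),\qquad \partial e(\emptyset,\widetilde{\mathsf m})=\widetilde{\mathsf m}.$$ *The operator $\gamma(a)$.* Let $a=(a_0,a_1,\dots)$ be a non-decreasing sequence of non-negative integers with $a_0=0$, and $T=\Bbbk[x_1,\dots,x_N]$, where $N\ge i+a_{j-1}$ for all $1\le i\le n$, $1\le j\le d$. Put $\mathsf m^{\gamma(a)}=\prod_{i=1}^e x_{\alpha_i+a_{i-1}}\in T$ and $I^{\gamma(a)}=(\mathsf m^{\gamma(a)}\mid \mathsf m\in G(I))\subset T$. Let $\Theta_a$ be any basis of the $\Bbbk$-subspace of $\widetilde S$ spanned by the $x_{i,j}-x_{i',j'}$ with $i+a_{j-1}=i'+a_{j'-1}$. Then the homomorphism $\widetilde S\to T$, $x_{i,j}\mapsto x_{i+a_{j-1}}$, induces an injective ring homomorphism $\widetilde S/(\Theta_a)\to T$, which is an isomorphism if every $l\in\{1,\dots,N\}$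 is of the form $i+a_{j-1}$ with $1\le i\le n$, $1\le j\le d$; and the complex $\widetilde P_\bullet\otimes_{\widetilde S}\widetilde S/(\Theta_a)$, with scalars extended to $T$ along this homomorphism, is a ($\mathbb Z^N$-graded) minimal $T$-free resolution of $T/I^{\gamma(a)}$. That is, it consists of free $T$-modules of finite rank with homogeneous bases and degree-preserving maps, it is exact in positive degrees, its $0$-th homology is $T/I^{\gamma(a)}$, and the image of each differential lies in $(x_1,\dots,x_N)$ times its target. In particular, for $a_i=i$ for all $i$, this complex is a minimal $T$-free resolution of $T/I^{\mathrm{sq}}$, where $I^{\mathrm{sq}}=(\mathsf m^{\mathrm{sq}}\mid \mathsf m\in G(I))$ and $\mathsf m^{\mathrm{sq}}=\prod_{i=1}^e x_{\alpha_i+i-1}$. -/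

import Mathlib

open MvPolynomial TensorProduct

noncomputable section

namespace BoxPol

universe u v w

/-! Monomials of a polynomial ring are represented by their exponent vectors.  All indices start
at `0`: the variable `x_{i,j}` (`1 ≤ i ≤ n`, `1 ≤ j ≤ d`) is `X (i - 1, j - 1)`, and the variable
`x_l` of `T` is `X (l - 1)`. -/

/-! ### Monomial ideals -/

section Ideals

variable {k : Type u} [Field k] {n : ℕ}

/-- `I` is generated by monomials. -/
def IsMonomialIdeal (I : Ideal (MvPolynomial (Fin n) k)) : Prop :=
  ∃ s : Set (Fin n →₀ ℕ), I = Ideal.span ((fun m => monomial m (1 : k)) '' s)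

/-- `G(I)`: the minimal monomial generators of a monomial ideal, i.e. the monomials of `I` that are
minimal for divisibility. -/
def G (I : Ideal (MvPolynomial (Fin n) k)) : Set (Fin n →₀ ℕ) :=
  {m | Minimal (fun s => monomial s (1 : k) ∈ I) m}

/-- Borel fixed (strongly stable): `m ∈ G(I)`, `x_i ∣ m` and `j < i` imply `(x_j / x_i) m ∈ I`. -/
def IsBorelFixed (I : Ideal (MvPolynomial (Fin n) k)) : Prop :=
  ∀ m ∈ G I, ∀ i ∈ m.support, ∀ j < i,
    monomial (m - Finsupp.single i 1 + Finsupp.single j 1) (1 : k) ∈ I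

end Ideals

/-- The sequence `α_1 ≤ α_2 ≤ ⋯ ≤ α_e` with `m = ∏ x_{α_i}`. -/
def alpha {n : ℕ} (m : Fin n →₀ ℕ) : List (Fin n) :=
  (Finsupp.toMultiset m).sort (· ≤ ·)

/-- The exponent vector of `b-pol(m) = ∏_j x_{α_j, j}`, for `deg m ≤ d`. -/
def bpol {n : ℕ} (d : ℕ) (m : Fin n →₀ ℕ) : Fin n × Fin d →₀ ℕ :=
  ∑ j : Fin d, if h : (j : ℕ) < (alpha m).length
    then Finsupp.single ((alpha m)[(j : ℕ)], j) 1 else 0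

/-- The exponent vector of `m^{γ(a)} = ∏_j x_{α_j + a_{j-1}}` in `N` variables, where `N` is large
enough for all the indices occurring. -/
def gammaMon {n : ℕ} (a : ℕ → ℕ) (N : ℕ) (m : Fin n →₀ ℕ) : Fin N →₀ ℕ :=
  ∑ j : Fin (alpha m).length, if h : ((alpha m)[j] : ℕ) + a j < N
    then Finsupp.single ⟨((alpha m)[j] : ℕ) + a j, h⟩ 1 else 0

/-- The exponent vector of `m^sq = ∏_j x_{α_j + j - 1}` in `N` variables, where `N` is large
enough for all the indices occurring. -/
def sqMon {n : ℕ} (N : ℕ) (m : Fin n →₀ ℕ) : Fin N →₀ ℕ :=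
  ∑ j : Fin (alpha m).length, if h : ((alpha m)[j] : ℕ) + (j : ℕ) < N
    then Finsupp.single ⟨((alpha m)[j] : ℕ) + (j : ℕ), h⟩ 1 else 0

section Operators

variable {k : Type u} [Field k] {n : ℕ}

/-- `I^{γ(a)} = (m^{γ(a)} ∣ m ∈ G(I)) ⊆ T = k[x_1, …, x_N]`. -/
def gammaIdeal (I : Ideal (MvPolynomial (Fin n) k)) (a : ℕ → ℕ) (N : ℕ) :
    Ideal (MvPolynomial (Fin N) k) :=
  Ideal.span ((fun m => monomial (gammaMon a N m) (1 : k)) '' G I)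

/-- `I^sq = (m^sq ∣ m ∈ G(I)) ⊆ T = k[x_1, …, x_N]`. -/
def sqIdeal (I : Ideal (MvPolynomial (Fin n) k)) (N : ℕ) : Ideal (MvPolynomial (Fin N) k) :=
  Ideal.span ((fun m => monomial (sqMon N m) (1 : k)) '' G I)

end Operators

/-! ### Admissible pairs and the complex `P̃` -/

open Classical in
/-- `𝔟_i(m) = (x_i / x_k) m` with `k = min {j > i ∣ x_j ∣ m}`, for `i < ν(m)`. -/
def fb {n : ℕ} (i : Fin n) (m : Fin n →₀ ℕ) : Fin n →₀ ℕ :=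
  if h : (m.support.filter (fun j => i < j)).Nonempty then
    m - Finsupp.single ((m.support.filter (fun j => i < j)).min' h) 1 + Finsupp.single i 1
  else m

section Complex

variable {k : Type u} [Field k] {n : ℕ}

open Classical in
/-- `g(m)` for a monomial `m ∈ I`: the element `m₁` of `G(I)` in the expression `m = m₁ m₂` with
`ν(m₁) ≤ μ(m₂)`. -/
def g (I : Ideal (MvPolynomial (Fin n) k)) (m : Fin n →₀ ℕ) : Fin n →₀ ℕ :=
  if h : ∃ m₁ ∈ G I, ∃ m₂ : Fin n →₀ ℕ,
      m = m₁ + m₂ ∧ ∀ p ∈ m₁.support, ∀ q ∈ m₂.support, p ≤ q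
  then h.choose else m

open Classical in
/-- `m_{⟨i⟩} = g(𝔟_i(m))` if `i < ν(m)`, and `m_{⟨i⟩} = m` otherwise. -/
def angle (I : Ideal (MvPolynomial (Fin n) k)) (m : Fin n →₀ ℕ) (i : Fin n) : Fin n →₀ ℕ :=
  if ∃ l ∈ m.support, i < l then g I (fb i m) else m

/-- `(F, b-pol(m))` is an admissible pair for `b-pol(I)`: `m ∈ G(I)` and every `(i, j) ∈ F`
satisfies `i < ν(m)` and `j = 1 + ∑_{l ≤ i} a_l`, where `m = ∏ x_l^{a_l}` (without the summand `1`
in the indexing from `0`).  As `j` is determined by `i`, the first components of the elements of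
`F` are pairwise distinct. -/
def Admissible {d : ℕ} (I : Ideal (MvPolynomial (Fin n) k))
    (F : Finset (Fin n × Fin d)) (m : Fin n →₀ ℕ) : Prop :=
  m ∈ G I ∧ ∀ p ∈ F, (∃ l ∈ m.support, p.1 < l) ∧ (p.2 : ℕ) = ∑ l ∈ Finset.Iic p.1, m l

/-- `A_q`: the admissible pairs with `#F = q`. -/
def A (I : Ideal (MvPolynomial (Fin n) k)) (d q : ℕ) : Type :=
  {p : Finset (Fin n × Fin d) × (Fin n →₀ ℕ) // Admissible I p.1 p.2 ∧ p.1.card = q}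

/-- The index set of the basis of `P̃_q`: one element for `q = 0`, and `A_{q-1}` for `q ≥ 1`. -/
def PIdx (I : Ideal (MvPolynomial (Fin n) k)) (d : ℕ) : ℕ → Type
  | 0 => Unit
  | q + 1 => A I d q

/-- `P̃_q`, a free module over `S̃ = k[x_{i,j}]` with `P̃_0 = S̃`. -/
abbrev P (I : Ideal (MvPolynomial (Fin n) k)) (d q : ℕ) : Type u :=
  PIdx I d q →₀ MvPolynomial (Fin n × Fin d) k

open Classical in
/-- The basis element `e(F, b-pol(m))` of `P̃_{q+1}`, for an admissible pair with `#F = q`. -/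
def e (I : Ideal (MvPolynomial (Fin n) k)) (d q : ℕ)
    (F : Finset (Fin n × Fin d)) (m : Fin n →₀ ℕ) : P I d (q + 1) :=
  if h : Admissible I F m ∧ F.card = q then
    Finsupp.single (α := PIdx I d (q + 1)) ⟨(F, m), h⟩ 1
  else 0

/-- The position `r ∈ {1, …, q}` of `p = (i_r, j_r)` in `F = {(i_1, j_1), …, (i_q, j_q)}` with
`i_1 < ⋯ < i_q`. -/
def pos {d : ℕ} (F : Finset (Fin n × Fin d)) (p : Fin n × Fin d) : ℕ :=
  (F.filter (fun p' => p'.1 ≤ p.1)).card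

open Classical in
/-- The image under `∂` of the basis elements of `P̃_{q+1}`. -/
def dBasis (I : Ideal (MvPolynomial (Fin n) k)) (d : ℕ) :
    (q : ℕ) → PIdx I d (q + 1) → P I d q
  | 0, ⟨(_, m), _⟩ => Finsupp.single (α := PIdx I d 0) () (monomial (bpol d m) 1)
  | q + 1, ⟨(F, m), _⟩ =>
      (∑ p ∈ F, ((-1) ^ pos F p * X p : MvPolynomial (Fin n × Fin d) k) • e I d q (F.erase p) m)
      - ∑ p ∈ F.filter (fun p => Admissible I (F.erase p) (angle I m p.1)),
          ((-1) ^ pos F p *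
              monomial (Finsupp.single p 1 + bpol d m - bpol d (angle I m p.1)) 1 :
            MvPolynomial (Fin n × Fin d) k) • e I d q (F.erase p) (angle I m p.1)

/-- The differential `∂ : P̃_{q+1} → P̃_q`. -/
def diff (I : Ideal (MvPolynomial (Fin n) k)) (d q : ℕ) :
    P I d (q + 1) →ₗ[MvPolynomial (Fin n × Fin d) k] P I d q :=
  Finsupp.linearCombination _ (dBasis I d q)

end Complex

/-! ### The linear forms `Θ_a` and the map `S̃ / (Θ_a) → T` -/

section Theta

variable (k : Type u) [Field k] (n d : ℕ) (a : ℕ → ℕ)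

/-- `L_a`, the `k`-span of the `x_{i,j} - x_{i',j'}` with `i + a_{j-1} = i' + a_{j'-1}`. -/
def L : Submodule k (MvPolynomial (Fin n × Fin d) k) :=
  Submodule.span k {f | ∃ p p' : Fin n × Fin d,
    (p.1 : ℕ) + a p.2 = (p'.1 : ℕ) + a p'.2 ∧ f = X p - X p'}

variable {n d a}

/-- The homomorphism `S̃ → T`, `x_{i,j} ↦ x_{i + a_{j-1}}`. -/
def toT {N : ℕ} (hN : ∀ (i : Fin n) (j : Fin d), (i : ℕ) + a j < N) :
    MvPolynomial (Fin n × Fin d) k →ₐ[k] MvPolynomial (Fin N) k :=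
  aeval fun p => X ⟨(p.1 : ℕ) + a p.2, hN p.1 p.2⟩

variable {k}

/-- The ideal `(Θ_a)` of `S̃` generated by a basis `Θ_a` of `L_a`. -/
def thetaIdeal {ι : Type v} (Θ : Module.Basis ι k (L k n d a)) :
    Ideal (MvPolynomial (Fin n × Fin d) k) :=
  Ideal.span (Set.range fun t => (Θ t : MvPolynomial (Fin n × Fin d) k))

theorem toT_eq_zero_of_mem_L {N : ℕ} (hN : ∀ (i : Fin n) (j : Fin d), (i : ℕ) + a j < N)
    {f : MvPolynomial (Fin n × Fin d) k} (hf : f ∈ L k n d a) : toT k hN f = 0 := by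
  have h : L k n d a ≤ LinearMap.ker (toT k hN).toLinearMap := by
    refine Submodule.span_le.2 ?_
    rintro _ ⟨p, p', h, rfl⟩
    simp [toT, h]
  exact h hf

theorem toT_eq_zero_of_mem_thetaIdeal {N : ℕ}
    (hN : ∀ (i : Fin n) (j : Fin d), (i : ℕ) + a j < N)
    {ι : Type v} (Θ : Module.Basis ι k (L k n d a))
    (f : MvPolynomial (Fin n × Fin d) k) (hf : f ∈ thetaIdeal Θ) :
    (toT k hN).toRingHom f = 0 := by
  have h : thetaIdeal Θ ≤ RingHom.ker (toT k hN).toRingHom := by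
    refine Ideal.span_le.2 ?_
    rintro _ ⟨t, rfl⟩
    exact toT_eq_zero_of_mem_L hN (Θ t).2
  exact h hf

/-- The induced homomorphism `S̃ / (Θ_a) → T`. -/
def thetaMap {N : ℕ} (hN : ∀ (i : Fin n) (j : Fin d), (i : ℕ) + a j < N)
    {ι : Type v} (Θ : Module.Basis ι k (L k n d a)) :
    (MvPolynomial (Fin n × Fin d) k ⧸ thetaIdeal Θ) →+* MvPolynomial (Fin N) k :=
  Ideal.Quotient.lift (thetaIdeal Θ) (toT k hN).toRingHom (toT_eq_zero_of_mem_thetaIdeal hN Θ)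

end Theta

/-! ### Extension of scalars along a ring homomorphism -/

section ExtScal

variable {R : Type u} {R' : Type v} [CommRing R] [CommRing R'] (f : R →+* R')

/-- `R' ⊗_R M`, where `R'` is an `R`-algebra through `f`. -/
def ExtScal (M : Type w) [AddCommGroup M] [Module R M] : Type (max v w) :=
  letI := f.toAlgebra
  R' ⊗[R] M

instance (M : Type w) [AddCommGroup M] [Module R M] : AddCommGroup (ExtScal f M) :=
  letI := f.toAlgebra
  (TensorProduct.addCommGroup : AddCommGroup (R' ⊗[R] M))

instance (M : Type w) [AddCommGroup M] [Module R M] : Module R' (ExtScal f M) :=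
  letI := f.toAlgebra
  (TensorProduct.leftModule : Module R' (R' ⊗[R] M))

/-- `id ⊗ l : R' ⊗_R M → R' ⊗_R M'`. -/
def ExtScal.map {M M' : Type w} [AddCommGroup M] [Module R M] [AddCommGroup M'] [Module R M']
    (l : M →ₗ[R] M') : ExtScal f M →ₗ[R'] ExtScal f M' :=
  letI := f.toAlgebra
  l.baseChange R'

end ExtScal

/-! ### The complex over `T` -/

section Tensor

variable {k : Type u} [Field k] {n d : ℕ} {a : ℕ → ℕ} {N : ℕ}

/-- `(P̃ ⊗_{S̃} S̃/(Θ_a))_q`, made a `T`-module by extension of scalars along `S̃/(Θ_a) → T`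
(which changes nothing if that map is an isomorphism). -/
abbrev PT (I : Ideal (MvPolynomial (Fin n) k))
    (hN : ∀ (i : Fin n) (j : Fin d), (i : ℕ) + a j < N)
    {ι : Type v} (Θ : Module.Basis ι k (L k n d a)) (q : ℕ) : Type u :=
  ExtScal (thetaMap hN Θ)
    ((MvPolynomial (Fin n × Fin d) k ⧸ thetaIdeal Θ) ⊗[MvPolynomial (Fin n × Fin d) k] P I d q)

/-- The differential of `P̃ ⊗_{S̃} S̃/(Θ_a)`, as a `T`-linear map. -/
def diffT (I : Ideal (MvPolynomial (Fin n) k))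
    (hN : ∀ (i : Fin n) (j : Fin d), (i : ℕ) + a j < N)
    {ι : Type v} (Θ : Module.Basis ι k (L k n d a)) (q : ℕ) :
    PT I hN Θ (q + 1) →ₗ[MvPolynomial (Fin N) k] PT I hN Θ q :=
  ExtScal.map (thetaMap hN Θ)
    ((diff I d q).baseChange (MvPolynomial (Fin n × Fin d) k ⧸ thetaIdeal Θ))

end Tensor

/-! ### Minimal free resolutions -/

/-- The sequence `⋯ → M 2 → M 1 → M 0 → 0` of `T`-modules, `T = k[x_1, …, x_N]`, is a (multigraded)
minimal `T`-free resolution of `T / J`: there is an augmentation `M 0 → T / J` making the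
sequence exact, every `M q` is free with a finite basis of elements of degree in `ℕ^N`, with respect
to which the maps preserve degrees, and the image of every differential lies in `𝔪 M`,
where `𝔪 = (x_1, …, x_N)`. -/
def IsMinimalFreeResolution {k : Type u} [Field k] {N : ℕ} (M : ℕ → Type v)
    [∀ q, AddCommGroup (M q)] [∀ q, Module (MvPolynomial (Fin N) k) (M q)]
    (δ : ∀ q, M (q + 1) →ₗ[MvPolynomial (Fin N) k] M q)
    (J : Ideal (MvPolynomial (Fin N) k)) : Prop :=
  ∃ (ε : M 0 →ₗ[MvPolynomial (Fin N) k] MvPolynomial (Fin N) k ⧸ J)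
    (rk : ℕ → ℕ)
    (b : ∀ q, Module.Basis (Fin (rk q)) (MvPolynomial (Fin N) k) (M q))
    (deg : ∀ q, Fin (rk q) → (Fin N →₀ ℕ)),
    Function.Surjective ε ∧
    Function.Exact (δ 0) ε ∧
    (∀ q, Function.Exact (δ (q + 1)) (δ q)) ∧
    (∀ t, ∃ c : k, ε (b 0 t) = Ideal.Quotient.mk J (monomial (deg 0 t) c)) ∧
    (∀ q t t', ∀ s ∈ ((b q).repr (δ q (b (q + 1) t)) t').support,
      s + deg q t' = deg (q + 1) t) ∧
    (∀ q, LinearMap.range (δ q) ≤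
      (Ideal.span (Set.range (X : Fin N → MvPolynomial (Fin N) k)) :
        Ideal (MvPolynomial (Fin N) k)) • (⊤ : Submodule (MvPolynomial (Fin N) k) (M q)))

end BoxPol

end

noncomputable section

namespace BoxPol

universe u v w

/-! A monomial is encoded by its partial degrees `cum m t`, the degree in the first `t` variables.
In these terms a Borel fixed ideal is closed under raising partial degrees
(`IsBorelFixed.mem_of_cum_le`), `fb i` raises by one the plateau of `cum m` that contains `i + 1`,
from `i + 1` onwards, `g` truncates at a height, and `bpol` is read off the staircase
(`bpol_apply`). A generator is determined by being a truncation of a given function, so identities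
between iterated `angle`s reduce to comparing truncations.

For the differential, fix a multidegree `D`: all monomial coefficients are then absorbed and only
signs remain (`IsBorelFixed.diff_ehom`). The square vanishes because the terms in which two elements
of `F` are removed are symmetric in these two (`IsBorelFixed.terms_comm`) while the signs are
antisymmetric.

Exactness is proved directly over `T`, without showing that `Θ_a` is a regular sequence. Ordering
the generators lexicographically, `angle` always yields a larger generator, so the second sum in the
differential strictly lowers `rank`. The graded piece of the resulting filtration at `m` is the
Koszul complex on the variables `X (phi hN p)` with `p` in `validSet d m`. They are pairwise
distinct because `a` is non-decreasing (`phi_injOn`), hence this complex is acyclic in positive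
degree (`exists_eq_koszul`). In the lowest degree the cycle condition is a colon condition, and the
image of `m` has a linear quotient by the images of the larger generators: that colon ideal lies in
the ideal of the same variables (`mem_span_X_of_mul_mem`). Induction on the rank concludes.

Base change carries the basis of `P` to a basis over `T` in which the differential is `dT`.
Minimality holds because every entry of `dT` is a combination of nonconstant monomials, and
`thetaMap` is injective because a section of `phi` inverts renaming modulo `Θ_a`. -/

/-! ### Partial degrees -/

section Cum

variable {n : ℕ}

/-- The degree of the part of `m` in the first `t` variables. -/
def cum (m : Fin n →₀ ℕ) (t : ℕ) : ℕ :=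
  ∑ l ∈ Finset.univ.filter (fun l : Fin n => (l : ℕ) < t), m l

theorem cum_mono (m : Fin n →₀ ℕ) : Monotone (cum m) := by
  intro s t h
  refine Finset.sum_le_sum_of_subset ?_
  intro l
  simp only [Finset.mem_filter, Finset.mem_univ, true_and]
  omega

@[simp] theorem cum_zero (m : Fin n →₀ ℕ) : cum m 0 = 0 := by simp [cum]

theorem cum_succ (m : Fin n →₀ ℕ) (i : Fin n) : cum m (i + 1) = cum m i + m i := by
  have h : Finset.univ.filter (fun l : Fin n => (l : ℕ) < i + 1)
      = insert i (Finset.univ.filter (fun l : Fin n => (l : ℕ) < i)) := by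
    ext l
    simp only [Finset.mem_filter, Finset.mem_univ, true_and, Finset.mem_insert, Fin.ext_iff]
    omega
  rw [cum, h, Finset.sum_insert (by simp), cum, add_comm]

theorem cum_of_le (m : Fin n →₀ ℕ) {t : ℕ} (h : n ≤ t) : cum m t = m.degree := by
  rw [cum, Finset.filter_true_of_mem (fun l _ => l.2.trans_le h), Finsupp.degree_eq_sum]

theorem cum_le_degree (m : Fin n →₀ ℕ) (t : ℕ) : cum m t ≤ m.degree := by
  rw [← cum_of_le m (le_max_right t n)]
  exact cum_mono m (le_max_left t n)

theorem cum_add (m m' : Fin n →₀ ℕ) (t : ℕ) : cum (m + m') t = cum m t + cum m' t := by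
  simp [cum, Finset.sum_add_distrib]

theorem cum_single (i : Fin n) (c t : ℕ) :
    cum (Finsupp.single i c) t = if (i : ℕ) < t then c else 0 := by
  simp only [cum, Finsupp.single_apply, Finset.sum_ite_eq, Finset.mem_filter, Finset.mem_univ,
    true_and]

theorem ext_cum {m m' : Fin n →₀ ℕ} (h : ∀ t, cum m t = cum m' t) : m = m' := by
  ext i
  have h1 := cum_succ m i
  have h2 := cum_succ m' i
  rw [h, h] at h1
  omega

theorem sum_Iic_eq_cum (m : Fin n →₀ ℕ) (i : Fin n) :
    ∑ l ∈ Finset.Iic i, m l = cum m (i + 1) := by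
  refine Finset.sum_congr ?_ fun _ _ => rfl
  ext l
  simp only [Finset.mem_Iic, Finset.mem_filter, Finset.mem_univ, true_and, Fin.le_def]
  omega

theorem cum_pos_iff (m : Fin n →₀ ℕ) (t : ℕ) :
    0 < cum m t ↔ ∃ l ∈ m.support, (l : ℕ) < t := by
  rw [cum, Finset.sum_pos_iff]
  constructor
  · rintro ⟨l, hl, h⟩
    exact ⟨l, by simpa using h.ne', by simpa using hl⟩
  · rintro ⟨l, hl, h⟩
    exact ⟨l, by simpa using h, Nat.pos_of_ne_zero (by simpa using hl)⟩

theorem exists_support_gt_iff (m : Fin n →₀ ℕ) (i : Fin n) :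
    (∃ l ∈ m.support, i < l) ↔ cum m (i + 1) < m.degree := by
  constructor
  · rintro ⟨l, hl, h⟩
    have h1 := cum_succ m l
    have h2 : cum m (i + 1) ≤ cum m l := cum_mono m (by have := Fin.lt_def.1 h; omega)
    have h3 := cum_le_degree m (l + 1)
    have h4 : m l ≠ 0 := by simpa using hl
    omega
  · intro h
    by_contra! hc
    refine h.ne ?_
    rw [← cum_of_le m le_rfl]
    refine Finset.sum_subset ?_ ?_
    · intro l _
      simp
    · intro l _ hl
      by_contra h0
      have := hc l (by simpa using h0)
      simp only [Finset.mem_filter, Finset.mem_univ, true_and] at hl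
      rw [Fin.le_def] at this
      omega

/-- Moving one factor from `x_κ` down to `x_i` adds one exactly for `i < t ≤ κ`. Since `κ` is the
first index after `i` in the support, this is the part with `i < t` of the plateau of `cum m` at
height `cum m (i + 1)`. -/
theorem cum_fb (m : Fin n →₀ ℕ) (i : Fin n) (h : cum m (i + 1) < m.degree) (t : ℕ) :
    cum (fb i m) t
      = if (i : ℕ) < t ∧ cum m t = cum m (i + 1) then cum m (i + 1) + 1 else cum m t := by
  classical
  have hne : (m.support.filter (fun j => i < j)).Nonempty := by
    obtain ⟨l, hl, hil⟩ := (exists_support_gt_iff m i).2 h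
    exact ⟨l, Finset.mem_filter.2 ⟨hl, hil⟩⟩
  have hfb : fb i m = m - Finsupp.single ((m.support.filter (fun j => i < j)).min' hne) 1
      + Finsupp.single i 1 := by
    rw [fb, dif_pos (by convert hne)]
  have hmem := Finset.min'_mem _ hne
  have hmin := fun l hl => Finset.min'_le (m.support.filter (fun j => i < j)) l hl
  set κ := (m.support.filter (fun j => i < j)).min' hne with hκ
  obtain ⟨hκm, hiκ⟩ := Finset.mem_filter.1 hmem
  have hle : Finsupp.single κ 1 ≤ m := by
    rw [Finsupp.single_le_iff]
    exact Nat.one_le_iff_ne_zero.2 (by simpa using hκm)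
  have h1 : cum (fb i m) t + cum (Finsupp.single κ 1) t = cum m t + cum (Finsupp.single i 1) t := by
    rw [← cum_add, ← cum_add, hfb, add_right_comm, tsub_add_cancel_of_le hle]
  have hiκ' := Fin.lt_def.1 hiκ
  rw [cum_single, cum_single] at h1
  have hflat : cum m κ = cum m (i + 1) := by
    refine (Finset.sum_subset ?_ ?_).symm
    · intro l
      simp only [Finset.mem_filter, Finset.mem_univ, true_and]
      omega
    · intro l
      simp only [Finset.mem_filter, Finset.mem_univ, true_and]
      intro hlκ hil
      by_contra hlm
      have := hmin l (Finset.mem_filter.2 ⟨by simpa using hlm, Fin.lt_def.2 (by omega)⟩)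
      rw [← hκ, Fin.le_def] at this
      omega
  have hκ1 : cum m (κ + 1) = cum m κ + m κ := cum_succ m κ
  have hκ0 : m κ ≠ 0 := by simpa using hκm
  rcases lt_or_ge (i : ℕ) t with hit | hit
  · have a1 : cum m (i + 1) ≤ cum m t := cum_mono m hit
    rcases lt_or_ge (κ : ℕ) t with hkt | hkt
    · have a2 : cum m (κ + 1) ≤ cum m t := cum_mono m hkt
      rw [if_pos hit, if_pos hkt] at h1
      rw [if_neg (by omega)]
      omega
    · have a2 : cum m t ≤ cum m κ := cum_mono m hkt
      rw [if_pos hit, if_neg (by omega)] at h1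
      rw [if_pos (by omega)]
      omega
  · rw [if_neg (by omega), if_neg (by omega)] at h1
    rw [if_neg (by omega)]
    omega

/-- The witness is the product of the first `c` factors of `m` in sorted order; its exponents are
the increments of the truncated function. -/
theorem exists_cum_eq_min (m : Fin n →₀ ℕ) (c : ℕ) :
    ∃ m' : Fin n →₀ ℕ, ∀ t, cum m' t = min (cum m t) c := by
  refine ⟨Finsupp.equivFunOnFinite.symm
    fun i : Fin n => min (cum m (i + 1)) c - min (cum m i) c, fun t => ?_⟩
  induction t with
  | zero => simp
  | succ t ih =>
    by_cases ht : t < n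
    · have h := cum_succ (Finsupp.equivFunOnFinite.symm
        fun i : Fin n => min (cum m (i + 1)) c - min (cum m i) c) ⟨t, ht⟩
      have h2 : cum m t ≤ cum m (t + 1) := cum_mono m (Nat.le_succ t)
      simp only [ih, Finsupp.coe_equivFunOnFinite_symm] at h
      rw [h]
      omega
    · have h2 : cum m (t + 1) = cum m t := by
        rw [cum_of_le m (by omega), cum_of_le m (by omega)]
      rw [h2, ← ih, cum_of_le _ (by omega), cum_of_le _ (by omega)]

theorem le_of_cum_eq_min {m m' : Fin n →₀ ℕ} {c : ℕ} (h : ∀ t, cum m' t = min (cum m t) c) :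
    m' ≤ m := by
  intro i
  have h1 := cum_succ m i
  have h2 := cum_succ m' i
  rw [h, h] at h2
  omega

/-- As soon as `m₂` contributes below `t`, all of `m₁` lies below `t`. With
`support_le_of_cum_eq_min` as converse, factorizations with separated supports are the same as
truncations of partial degrees. -/
theorem cum_eq_min_of_add {m₁ m₂ : Fin n →₀ ℕ}
    (h : ∀ p ∈ m₁.support, ∀ q ∈ m₂.support, p ≤ q) (t : ℕ) :
    cum m₁ t = min (cum (m₁ + m₂) t) m₁.degree := by
  rw [cum_add]
  have h1 := cum_le_degree m₁ t
  rcases Nat.eq_zero_or_pos (cum m₂ t) with h0 | h0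
  · omega
  · obtain ⟨q, hq, hqt⟩ := (cum_pos_iff m₂ t).1 h0
    have : ¬ ∃ l ∈ m₁.support, q < l := by
      rintro ⟨l, hl, hql⟩
      exact absurd (h l hl q hq) (not_le.2 hql)
    rw [exists_support_gt_iff] at this
    have h2 : cum m₁ (q + 1) ≤ cum m₁ t := cum_mono m₁ hqt
    omega

theorem support_le_of_cum_eq_min {m₁ m : Fin n →₀ ℕ}
    (h : ∀ t, cum m₁ t = min (cum m t) m₁.degree) :
    ∀ p ∈ m₁.support, ∀ q ∈ (m - m₁).support, p ≤ q := by
  intro p hp q hq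
  by_contra! hlt
  have h1 := cum_succ m₁ p
  have h2 : m₁ p ≠ 0 := by simpa using hp
  have h3 := cum_le_degree m₁ (p + 1)
  have h4 : cum m₁ (q + 1) ≤ cum m₁ p := cum_mono m₁ (by have := Fin.lt_def.1 hlt; omega)
  have h5 := cum_succ m₁ q
  have h6 := cum_succ m q
  have h7 := h q
  have h8 := h (q + 1)
  have h9 : m q - m₁ q ≠ 0 := by simpa using hq
  omega

end Cum

/-! ### Borel fixed ideals and partial degrees -/

section Borel

variable {k : Type u} [Field k] {n : ℕ} {I : Ideal (MvPolynomial (Fin n) k)}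

theorem monomial_mem_of_le {m m' : Fin n →₀ ℕ} (h : monomial m (1 : k) ∈ I) (hle : m ≤ m') :
    monomial m' (1 : k) ∈ I := by
  have : monomial m' (1 : k) = monomial (m' - m) 1 * monomial m 1 := by
    rw [monomial_mul, tsub_add_cancel_of_le hle, one_mul]
  rw [this]
  exact I.mul_mem_left _ h

theorem exists_mem_G_le {m : Fin n →₀ ℕ} (h : monomial m (1 : k) ∈ I) : ∃ u ∈ G I, u ≤ m := by
  obtain ⟨u, hu, hmin⟩ := exists_minimal_le_of_wellFoundedLT
    (fun s => monomial s (1 : k) ∈ I) m h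
  exact ⟨u, hmin, hu⟩

/-- The exchange property is only assumed for generators. Take a generator `u` dividing `m`: if it
does not use up all factors `x_κ` of `m`, it still divides after one is removed; otherwise `κ` is in
its support and the exchange is made in `u`. -/
theorem IsBorelFixed.fb_mem (hB : IsBorelFixed I) {m : Fin n →₀ ℕ} (h : monomial m (1 : k) ∈ I)
    (i : Fin n) : monomial (fb i m) (1 : k) ∈ I := by
  classical
  rw [fb]
  split_ifs with hne
  swap
  · exact h
  have hmem := Finset.min'_mem _ hne
  set κ := (m.support.filter (fun j => i < j)).min' hne
  obtain ⟨hκm, hiκ⟩ := Finset.mem_filter.1 hmem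
  have hκ0 : m κ ≠ 0 := by simpa using hκm
  obtain ⟨u, hu, hum⟩ := exists_mem_G_le h
  by_cases hκ : u κ < m κ
  · refine monomial_mem_of_le hu.1 (le_trans (fun l => ?_) le_self_add)
    have := hum l
    rw [Finsupp.tsub_apply, Finsupp.single_apply]
    split_ifs with hl
    · subst hl
      omega
    · omega
  · refine monomial_mem_of_le (hB u hu κ ?_ i hiκ) (add_le_add_left (tsub_le_tsub_right hum _) _)
    have := hum κ
    simp only [Finsupp.mem_support_iff]
    omega

/-- A Borel fixed ideal is closed under passing to monomials with larger partial degrees. -/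
theorem IsBorelFixed.mem_of_cum_le (hB : IsBorelFixed I) {m m' : Fin n →₀ ℕ}
    (h : monomial m (1 : k) ∈ I) (hle : ∀ t, cum m t ≤ cum m' t) : monomial m' (1 : k) ∈ I := by
  induction hs : ∑ t ∈ Finset.range (n + 1), (cum m' t - cum m t) using Nat.strong_induction_on
    generalizing m with
  | _ s ih =>
    by_cases hall : ∀ t, cum m t = cum m' t
    · rwa [← ext_cum hall]
    push Not at hall
    have hex : ∃ i : Fin n, cum m (i + 1) < cum m' (i + 1) := by
      obtain ⟨t, ht⟩ := hall
      have htl := lt_of_le_of_ne (hle t) ht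
      rcases Nat.eq_zero_or_pos t with rfl | h0
      · simp at htl
      by_cases htn : t ≤ n
      · refine ⟨⟨t - 1, by omega⟩, ?_⟩
        have : t - 1 + 1 = t := by omega
        simpa only [this] using htl
      · have hn : 0 < n := by
          rcases Nat.eq_zero_or_pos n with rfl | h
          · simp [cum] at htl
          · exact h
        refine ⟨⟨n - 1, by omega⟩, ?_⟩
        have : n - 1 + 1 = n := by omega
        simp only [this]
        rwa [cum_of_le _ (by omega), cum_of_le _ (by omega), ← cum_of_le _ le_rfl,
          ← cum_of_le _ le_rfl] at htl
    obtain ⟨i, hi⟩ := hex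
    -- If `m` has a factor beyond `x_i`, exchange it with `fb`; if not, multiply by `x_i`. Both
    -- moves have the same effect on partial degrees, and the total gap to `m'` shrinks.
    obtain ⟨u, hu, hcum⟩ : ∃ u : Fin n →₀ ℕ, monomial u (1 : k) ∈ I ∧ ∀ t, cum u t =
        if (i : ℕ) < t ∧ cum m t = cum m (i + 1) then cum m (i + 1) + 1 else cum m t := by
      by_cases hv : cum m (i + 1) < m.degree
      · exact ⟨fb i m, hB.fb_mem h i, cum_fb m i hv⟩
      · refine ⟨m + Finsupp.single i 1, monomial_mem_of_le h le_self_add, fun t => ?_⟩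
        rw [cum_add, cum_single]
        by_cases hit : (i : ℕ) < t
        · have h1 : cum m (i + 1) ≤ cum m t := cum_mono m hit
          have h2 := cum_le_degree m t
          rw [if_pos hit, if_pos (by omega)]
          omega
        · rw [if_neg hit, if_neg (by omega)]
          rfl
    have hle' : ∀ t, cum u t ≤ cum m' t := by
      intro t
      rw [hcum]
      split_ifs with hc
      · have : cum m' (i + 1) ≤ cum m' t := cum_mono m' hc.1
        omega
      · exact hle t
    refine ih _ ?_ hu hle' rfl
    rw [← hs]
    refine Finset.sum_lt_sum (fun t _ => ?_) ⟨i + 1, by simp, ?_⟩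
    · have : cum m t ≤ cum u t := by
        rw [hcum]
        split_ifs <;> omega
      omega
    · rw [hcum, if_pos (by simp)]
      omega

theorem eq_of_cum_eq_min {m m' : Fin n →₀ ℕ} (hm : m ∈ G I) (hm' : m' ∈ G I) {c : ℕ}
    (h : ∀ t, cum m' t = min (cum m t) c) : m' = m :=
  le_antisymm (le_of_cum_eq_min h) (hm.2 hm'.1 (le_of_cum_eq_min h))

/-- One of two truncations of `D` is a truncation of the other, hence divides it, and minimality of
generators applies. `D` need not come from a monomial, so this compares iterated `angle`s without
naming intermediate monomials. -/
theorem eq_of_cum_eq_min_of_cum_eq_min {m m' : Fin n →₀ ℕ} (hm : m ∈ G I) (hm' : m' ∈ G I)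
    {D : ℕ → ℕ} {c c' : ℕ} (h : ∀ t, cum m t = min (D t) c) (h' : ∀ t, cum m' t = min (D t) c') :
    m = m' := by
  rcases le_total c c' with hc | hc
  · refine eq_of_cum_eq_min hm' hm (c := c) fun t => ?_
    rw [h, h']
    omega
  · refine (eq_of_cum_eq_min hm hm' (c := c') fun t => ?_).symm
    rw [h, h']
    omega

/-- The shortest sorted prefix of `m` lying in `I` is a minimal generator: a divisor `u` in `I` is
dominated in partial degrees by the prefix of length `u.degree`, which then lies in `I` too, so `u`
cannot be shorter. -/
theorem IsBorelFixed.exists_prefix (hB : IsBorelFixed I) {m : Fin n →₀ ℕ}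
    (h : monomial m (1 : k) ∈ I) : ∃ m' ∈ G I, ∀ t, cum m' t = min (cum m t) m'.degree := by
  classical
  have hex : ∃ c, ∃ m' : Fin n →₀ ℕ, monomial m' (1 : k) ∈ I ∧ ∀ t, cum m' t = min (cum m t) c :=
    ⟨m.degree, m, h, fun t => (min_eq_left (cum_le_degree m t)).symm⟩
  obtain ⟨m', hm', hc⟩ := Nat.find_spec hex
  have hdeg : m'.degree = min m.degree (Nat.find hex) := by
    rw [← cum_of_le m' le_rfl, hc, cum_of_le m le_rfl]
  have hc' : ∀ t, cum m' t = min (cum m t) m'.degree := by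
    intro t
    have := cum_le_degree m t
    rw [hc, hdeg]
    omega
  have hfind : Nat.find hex = m'.degree :=
    le_antisymm (Nat.find_min' hex ⟨m', hm', hc'⟩) (by omega)
  refine ⟨m', ⟨hm', fun u hu hum => ?_⟩, hc'⟩
  have hcu : ∀ t, cum u t ≤ cum m' t := fun t => Finset.sum_le_sum fun l _ => hum l
  obtain ⟨w, hw⟩ := exists_cum_eq_min m u.degree
  have hwI : monomial w (1 : k) ∈ I := by
    refine hB.mem_of_cum_le hu fun t => ?_
    have h1 := hcu t
    have h2 := cum_le_degree u t
    have h3 := hc' t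
    rw [hw]
    omega
  have hdu : m'.degree ≤ u.degree := hfind ▸ Nat.find_min' hex ⟨w, hwI, hw⟩
  obtain ⟨x, hx⟩ := le_iff_exists_add.1 hum
  have : x.degree = 0 := by
    have := congrArg Finsupp.degree hx
    rw [map_add] at this
    omega
  rw [Finsupp.degree_eq_zero_iff] at this
  rw [hx, this, add_zero]

theorem IsBorelFixed.g_spec (hB : IsBorelFixed I) {m : Fin n →₀ ℕ} (h : monomial m (1 : k) ∈ I) :
    g I m ∈ G I ∧ ∀ t, cum (g I m) t = min (cum m t) (g I m).degree := by
  have hex : ∃ m₁ ∈ G I, ∃ m₂ : Fin n →₀ ℕ,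
      m = m₁ + m₂ ∧ ∀ p ∈ m₁.support, ∀ q ∈ m₂.support, p ≤ q := by
    obtain ⟨m', hm', hc⟩ := hB.exists_prefix h
    exact ⟨m', hm', m - m', (add_tsub_cancel_of_le (le_of_cum_eq_min hc)).symm,
      support_le_of_cum_eq_min hc⟩
  rw [g, dif_pos hex]
  obtain ⟨h1, m₂, h2, h3⟩ := hex.choose_spec
  refine ⟨h1, fun t => ?_⟩
  have := cum_eq_min_of_add h3 t
  rwa [← h2] at this

/-- The partial degrees of `m_{⟨i⟩}`. -/
theorem IsBorelFixed.angle_spec (hB : IsBorelFixed I) {m : Fin n →₀ ℕ} (hm : m ∈ G I) {i : Fin n}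
    (hi : cum m (i + 1) < m.degree) :
    angle I m i ∈ G I ∧ cum m (i + 1) < (angle I m i).degree ∧ (angle I m i).degree ≤ m.degree ∧
      ∀ t, cum (angle I m i) t = min (if (i : ℕ) < t ∧ cum m t = cum m (i + 1)
        then cum m (i + 1) + 1 else cum m t) (angle I m i).degree := by
  have hang : angle I m i = g I (fb i m) := by
    rw [angle, if_pos ((exists_support_gt_iff m i).2 hi)]
  obtain ⟨h1, h2⟩ := hB.g_spec (hB.fb_mem hm.1 i)
  rw [← hang] at h1 h2
  have h3 := fun t => (h2 t).trans (by rw [cum_fb m i hi])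
  refine ⟨h1, ?_, ?_, h3⟩
  -- Cutting at or below height `cum m (i + 1)` would erase the raised plateau, leaving a truncation
  -- of `m` itself; minimality would make it equal to `m`, which is too long. So the new factor
  -- `x_i` survives in `angle I m i`.
  · by_contra! hlt
    have : angle I m i = m := by
      refine eq_of_cum_eq_min hm h1 (c := (angle I m i).degree) fun t => ?_
      rw [h3]
      split_ifs with hc
      · rw [min_eq_right (by omega), min_eq_right (by omega)]
      · rfl
    rw [this] at hlt
    omega
  · have := h3 n
    rw [cum_of_le _ le_rfl, cum_of_le _ le_rfl, if_neg (by omega)] at this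
    omega

end Borel

/-! ### The exponents of `b-pol(m)` -/

/-- The entries below `t` of a sorted list form an initial segment. -/
theorem getElem_lt_iff_lt_countP {l : List ℕ} (hl : l.Pairwise (· ≤ ·)) (t j : ℕ)
    (hj : j < l.length) : l[j] < t ↔ j < l.countP (fun x => decide (x < t)) := by
  induction l generalizing j with
  | nil => simp at hj
  | cons x l ih =>
    rw [List.pairwise_cons] at hl
    rw [List.countP_cons]
    by_cases hx : x < t
    · cases j with
      | zero => simp [hx]
      | succ j =>
        simp only [List.getElem_cons_succ, hx, decide_true, if_true]
        rw [ih hl.2 j (by simpa using hj)]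
        omega
    · have h0 : l.countP (fun x => decide (x < t)) = 0 := by
        rw [List.countP_eq_zero]
        intro y hy
        have := hl.1 y hy
        simp only [decide_eq_true_eq]
        omega
      have h1 : ¬ (x :: l)[j] < t := by
        have : x ≤ (x :: l)[j] := by
          cases j with
          | zero => simp
          | succ j => exact hl.1 _ (by simp)
        omega
      simp [h0, hx, h1]

section Bpol

variable {n : ℕ}

theorem countP_toMultiset (m : Fin n →₀ ℕ) (t : ℕ) :
    (Finsupp.toMultiset m).countP (fun l : Fin n => (l : ℕ) < t) = cum m t := by
  induction m using Finsupp.induction_linear with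
  | zero => simp [cum]
  | add m m' h h' => rw [map_add, Multiset.countP_add, h, h', cum_add]
  | single i c =>
    rw [Finsupp.toMultiset_single, Multiset.countP_nsmul, cum_single, ← Multiset.cons_zero,
      Multiset.countP_cons]
    simp

theorem length_alpha (m : Fin n →₀ ℕ) : (alpha m).length = m.degree := by
  rw [alpha, Multiset.length_sort, Finsupp.card_toMultiset, Finsupp.degree_apply]
  rfl

theorem alpha_getElem_lt_iff (m : Fin n →₀ ℕ) (t j : ℕ) (hj : j < (alpha m).length) :
    ((alpha m)[j] : ℕ) < t ↔ j < cum m t := by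
  have hs : ((alpha m).map (fun l : Fin n => (l : ℕ))).Pairwise (· ≤ ·) := by
    rw [List.pairwise_map]
    exact (Multiset.pairwise_sort (Finsupp.toMultiset m) (· ≤ ·)).imp fun h => h
  have h := getElem_lt_iff_lt_countP hs t j (by simpa using hj)
  rw [List.getElem_map] at h
  rw [h, List.countP_map, ← countP_toMultiset]
  have : (Finsupp.toMultiset m) = ((alpha m : List (Fin n)) : Multiset (Fin n)) :=
    (Multiset.sort_eq _ _).symm
  rw [this, Multiset.coe_countP]
  rfl

theorem alpha_getElem_eq_iff (m : Fin n →₀ ℕ) (i : Fin n) (j : ℕ) (hj : j < (alpha m).length) :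
    (alpha m)[j] = i ↔ cum m i ≤ j ∧ j < cum m (i + 1) := by
  rw [← alpha_getElem_lt_iff m (i + 1) j hj, ← not_lt, ← alpha_getElem_lt_iff m i j hj,
    Fin.ext_iff]
  omega

theorem bpol_apply (d : ℕ) (m : Fin n →₀ ℕ) (p : Fin n × Fin d) :
    bpol d m p = if cum m p.1 ≤ p.2 ∧ (p.2 : ℕ) < cum m (p.1 + 1) then 1 else 0 := by
  classical
  obtain ⟨i, j⟩ := p
  rw [bpol, Finsupp.finsetSum_apply, Finset.sum_eq_single j]
  · by_cases h : (j : ℕ) < (alpha m).length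
    · rw [dif_pos h, Finsupp.single_apply]
      simp only [Prod.mk.injEq, and_true, alpha_getElem_eq_iff m i j h]
    · rw [dif_neg h, if_neg, Finsupp.zero_apply]
      have := cum_le_degree m (i + 1)
      rw [length_alpha] at h
      simp only
      omega
  · intro b _ hb
    split_ifs
    · rw [Finsupp.single_apply, if_neg]
      simp [hb]
    · rfl
  · simp

theorem gammaMon_eq_mapDomain {d : ℕ} {a : ℕ → ℕ} {N : ℕ}
    (hN : ∀ (i : Fin n) (j : Fin d), (i : ℕ) + a j < N) {m : Fin n →₀ ℕ} (hm : m.degree ≤ d) :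
    gammaMon a N m = (bpol d m).mapDomain
      (fun p : Fin n × Fin d => (⟨(p.1 : ℕ) + a p.2, hN p.1 p.2⟩ : Fin N)) := by
  set f : ℕ → (Fin N →₀ ℕ) := fun j => if h : j < (alpha m).length then
    (if h' : ((alpha m)[j] : ℕ) + a j < N
      then Finsupp.single ⟨((alpha m)[j] : ℕ) + a j, h'⟩ 1 else 0) else 0 with hf
  have h1 : gammaMon a N m = ∑ j ∈ Finset.range (alpha m).length, f j := by
    rw [← Fin.sum_univ_eq_sum_range, gammaMon]
    refine Finset.sum_congr rfl fun j _ => ?_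
    simp only [hf, dif_pos j.2]
    rfl
  have h2 : (bpol d m).mapDomain
      (fun p : Fin n × Fin d => (⟨(p.1 : ℕ) + a p.2, hN p.1 p.2⟩ : Fin N))
      = ∑ j ∈ Finset.range d, f j := by
    rw [← Fin.sum_univ_eq_sum_range, bpol, Finsupp.mapDomain_finsetSum]
    refine Finset.sum_congr rfl fun j _ => ?_
    simp only [hf]
    by_cases h : (j : ℕ) < (alpha m).length
    · rw [dif_pos h, dif_pos h, dif_pos (hN _ _), Finsupp.mapDomain_single]
    · rw [dif_neg h, dif_neg h, Finsupp.mapDomain_zero]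
  rw [h1, h2]
  refine Finset.sum_subset (Finset.range_subset_range.2 (by rwa [length_alpha])) fun j _ hj => ?_
  simp only [hf]
  rw [dif_neg (by simpa using hj)]

theorem bpol_ne_zero {d : ℕ} {m : Fin n →₀ ℕ} (hm : m.degree ≤ d) (h0 : m ≠ 0) :
    bpol d m ≠ 0 := by
  have hdeg : 0 < (alpha m).length := by
    rw [length_alpha]
    exact Nat.pos_of_ne_zero fun h => h0 ((Finsupp.degree_eq_zero_iff m).1 h)
  intro h
  have h1 : bpol d m ((alpha m)[0], ⟨0, by rw [length_alpha] at hdeg; omega⟩) = 1 := by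
    rw [bpol_apply, if_pos ((alpha_getElem_eq_iff m _ 0 hdeg).1 rfl)]
  rw [h] at h1
  simp at h1

end Bpol

/-! ### Divisibility between the polarizations of `m` and of `angle I m i` -/

section Angle

variable {k : Type u} [Field k] {n d : ℕ} {I : Ideal (MvPolynomial (Fin n) k)}

theorem admissible_iff {F : Finset (Fin n × Fin d)} {m : Fin n →₀ ℕ} :
    Admissible I F m ↔ m ∈ G I ∧
      ∀ p ∈ F, cum m (p.1 + 1) < m.degree ∧ (p.2 : ℕ) = cum m (p.1 + 1) := by
  simp only [Admissible, exists_support_gt_iff, sum_Iic_eq_cum]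

/-- Replacing the first factor `x_κ` with `κ > i` by `x_i` keeps the sorted order of the factors, so
the polarization changes only in position `p.2 = cum m (p.1 + 1)`, where the new variable is `X p`;
truncation only drops factors. -/
theorem IsBorelFixed.bpol_angle_le (hB : IsBorelFixed I) {m : Fin n →₀ ℕ} (hm : m ∈ G I)
    {p : Fin n × Fin d} (hp : cum m (p.1 + 1) < m.degree) (hp' : (p.2 : ℕ) = cum m (p.1 + 1)) :
    bpol d (angle I m p.1) ≤ Finsupp.single p 1 + bpol d m := by
  classical
  obtain ⟨-, h1, -, h2⟩ := hB.angle_spec hm hp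
  intro q
  rw [Finsupp.add_apply, bpol_apply, bpol_apply, Finsupp.single_apply, h2, h2]
  have hle : ∀ P : Prop, ∀ _ : Decidable P, (if P then 1 else 0 : ℕ) ≤ 1 := by
    intro P _
    split_ifs <;> omega
  by_cases hpq : p = q
  · rw [if_pos hpq]
    exact (hle _ _).trans (Nat.le_add_right _ _)
  rw [if_neg hpq, zero_add]
  by_cases hC : cum m q.1 ≤ q.2 ∧ (q.2 : ℕ) < cum m (q.1 + 1)
  · rw [if_pos hC]
    exact hle _ _
  have hne : (p.1 : ℕ) ≠ q.1 ∨ (p.2 : ℕ) ≠ q.2 := by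
    by_contra! hc
    exact hpq (Prod.ext (Fin.ext hc.1) (Fin.ext hc.2))
  have m1 := cum_mono m (Nat.le_succ q.1)
  have m2 : (p.1 : ℕ) < q.1 → cum m (p.1 + 1) ≤ cum m q.1 := fun h => cum_mono m h
  have m3 : (q.1 : ℕ) < p.1 → cum m (q.1 + 1) ≤ cum m p.1 := fun h => cum_mono m h
  have m4 := cum_mono m (Nat.le_succ p.1)
  have m5 : (p.1 : ℕ) = q.1 → cum m (p.1 + 1) = cum m (q.1 + 1) := fun h => by rw [h]
  simp only [Nat.succ_eq_add_one] at m1 m4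
  rw [if_neg hC, if_neg]
  rintro ⟨hA1, hA2⟩
  split_ifs at hA1 hA2 <;> omega

/-- The quotient `x_{i,j} b-pol(m) / b-pol(m_{⟨i⟩})` is not constant. -/
theorem IsBorelFixed.single_add_bpol_sub_ne_zero (hB : IsBorelFixed I) {m : Fin n →₀ ℕ}
    (hm : m ∈ G I)
    {p : Fin n × Fin d} (hp : cum m (p.1 + 1) < m.degree) (hp' : (p.2 : ℕ) = cum m (p.1 + 1)) :
    Finsupp.single p 1 + bpol d m - bpol d (angle I m p.1) ≠ 0 := by
  classical
  intro h0
  obtain ⟨-, h1, -, h2⟩ := hB.angle_spec hm hp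
  have hj : (p.2 : ℕ) < (alpha m).length := by rw [length_alpha]; omega
  have hα := (alpha_getElem_eq_iff m _ p.2 hj).1 rfl
  set q := (alpha m)[(p.2 : ℕ)] with hq
  -- The variable that survives in the quotient is the one of `bpol d m` in position `p.2`: there
  -- `angle I m p.1` has the factor `x_i`, with `i < q`, instead.
  have h3 := DFunLike.congr_fun h0 (q, p.2)
  have hpq : (p.1 : ℕ) < q := by
    by_contra! hc
    have := cum_mono m (show (q : ℕ) + 1 ≤ p.1 + 1 by omega)
    omega
  have hpq' : cum m (p.1 + 1) ≤ cum m q := cum_mono m hpq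
  rw [Finsupp.tsub_apply, Finsupp.add_apply, bpol_apply, bpol_apply, if_pos hα, Finsupp.coe_zero,
    Pi.zero_apply] at h3
  rw [if_neg] at h3
  · omega
  · simp only [h2]
    rw [if_pos (by omega)]
    omega

end Angle

/-! ### Iterating `m ↦ m_{⟨i⟩}` -/

section Iterate

variable {k : Type u} [Field k] {n d : ℕ} {I : Ideal (MvPolynomial (Fin n) k)}
  {m : Fin n →₀ ℕ}

theorem IsBorelFixed.min_cum_le_cum_angle (hB : IsBorelFixed I) (hm : m ∈ G I) {i : Fin n}
    (hi : cum m (i + 1) < m.degree) (t : ℕ) :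
    min (cum m t) (angle I m i).degree ≤ cum (angle I m i) t := by
  obtain ⟨-, -, -, h⟩ := hB.angle_spec hm hi
  rw [h]
  split_ifs <;> omega

/-- Raising happens only at `t > i'` and truncation stays above height `cum m (i' + 1)`. Hence a
smaller element of `F` always stays valid after `angle` at a larger one; the reverse can fail. -/
theorem IsBorelFixed.cum_angle_of_lt (hB : IsBorelFixed I) (hm : m ∈ G I) {i i' : Fin n}
    (hii : i < i') (hi : cum m (i' + 1) < m.degree) :
    cum (angle I m i') (i + 1) = cum m (i + 1) ∧
      cum m (i + 1) < (angle I m i').degree := by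
  obtain ⟨-, h1, -, h⟩ := hB.angle_spec hm hi
  have h2 := Fin.lt_def.1 hii
  have h3 : cum m (i + 1) ≤ cum m (i' + 1) := cum_mono m (by omega)
  rw [h, if_neg (by omega)]
  omega

/-- A position valid for `m` and for `(m_{⟨i⟩})_{⟨i'⟩}` is valid for `m_{⟨i⟩}`. -/
theorem IsBorelFixed.valid_of_valid_angle_angle (hB : IsBorelFixed I) (hm : m ∈ G I) {i i' : Fin n}
    (hi : cum m (i + 1) < m.degree)
    (hi' : cum (angle I m i) (i' + 1) < (angle I m i).degree) {t j : ℕ} (hj : j = cum m t)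
    (h : cum (angle I (angle I m i) i') t < (angle I (angle I m i) i').degree ∧
      j = cum (angle I (angle I m i) i') t) :
    cum (angle I m i) t < (angle I m i).degree ∧ j = cum (angle I m i) t := by
  obtain ⟨h1, -, -, -⟩ := hB.angle_spec hm hi
  obtain ⟨-, -, h2, -⟩ := hB.angle_spec h1 hi'
  -- Up to truncation, partial degrees only grow under `angle`, so equality at both ends forces
  -- equality in the middle.
  have h3 := hB.min_cum_le_cum_angle hm hi t
  have h4 := hB.min_cum_le_cum_angle h1 hi' t
  omega

/-- The hypothesis `hv'` puts `i` and `i'` on different plateaus of `cum m`. The two raisings are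
then independent, and either order gives a truncation of the function with both plateaus raised. -/
theorem IsBorelFixed.angle_angle_comm (hB : IsBorelFixed I) (hm : m ∈ G I) {i i' : Fin n}
    (hii : i < i') (hi' : cum m (i' + 1) < m.degree)
    (hv : cum (angle I m i) (i' + 1) < (angle I m i).degree)
    (hv' : cum (angle I m i) (i' + 1) = cum m (i' + 1)) :
    angle I (angle I m i) i' = angle I (angle I m i') i := by
  have hlt := Fin.lt_def.1 hii
  have hmono : cum m (i + 1) ≤ cum m (i' + 1) := cum_mono m (by omega)
  obtain ⟨u1, u2, u3, u4⟩ := hB.angle_spec hm (i := i) (by omega)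
  obtain ⟨v1, v2, v3, v4⟩ := hB.angle_spec hm hi'
  obtain ⟨c1, c2⟩ := hB.cum_angle_of_lt hm hii hi'
  obtain ⟨x1, x2, x3, x4⟩ := hB.angle_spec u1 hv
  obtain ⟨y1, y2, y3, y4⟩ := hB.angle_spec v1 (i := i) (by omega)
  have hne : cum m (i + 1) ≠ cum m (i' + 1) := by
    intro h
    have := u4 (i' + 1)
    rw [if_pos (by omega)] at this
    omega
  rw [hv'] at x2 x4
  rw [c1] at y2 y4
  refine eq_of_cum_eq_min_of_cum_eq_min x1 y1 (c := (angle I (angle I m i) i').degree)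
    (c' := (angle I (angle I m i') i).degree)
    (D := fun t => if (i' : ℕ) < t ∧ cum m t = cum m (i' + 1) then cum m (i' + 1) + 1
      else if (i : ℕ) < t ∧ cum m t = cum m (i + 1) then cum m (i + 1) + 1 else cum m t)
    (fun t => (x4 t).trans ?_) (fun t => (y4 t).trans ?_)
  · have m1 : (i' : ℕ) < t → cum m (i' + 1) ≤ cum m t := fun h => cum_mono m h
    have := u4 t
    split_ifs at this ⊢ <;> omega
  · have m1 : t ≤ (i' : ℕ) → cum m t ≤ cum m (i' + 1) := fun h => cum_mono m (by omega)
    have m2 : (i' : ℕ) < t → cum m (i' + 1) ≤ cum m t := fun h => cum_mono m h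
    have := v4 t
    split_ifs at this ⊢ <;> omega

/-- The position of `i'` is lost in one of two ways. Either both indices lie on one plateau, and
raising it from `i'` and then from `i` amounts to raising it from `i`; or `angle I m i` is truncated
at or below height `cum m (i' + 1)`, where raising at `i'` is invisible. -/
theorem IsBorelFixed.angle_angle_eq_angle (hB : IsBorelFixed I) (hm : m ∈ G I) {i i' : Fin n}
    (hii : i < i') (hi' : cum m (i' + 1) < m.degree)
    (hv : ¬ (cum (angle I m i) (i' + 1) < (angle I m i).degree ∧
      cum (angle I m i) (i' + 1) = cum m (i' + 1))) :
    angle I (angle I m i') i = angle I m i := by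
  have hlt := Fin.lt_def.1 hii
  have hmono : cum m (i + 1) ≤ cum m (i' + 1) := cum_mono m (by omega)
  obtain ⟨u1, u2, u3, u4⟩ := hB.angle_spec hm (i := i) (by omega)
  obtain ⟨v1, v2, v3, v4⟩ := hB.angle_spec hm hi'
  obtain ⟨c1, c2⟩ := hB.cum_angle_of_lt hm hii hi'
  obtain ⟨y1, y2, y3, y4⟩ := hB.angle_spec v1 (i := i) (by omega)
  rw [c1] at y2 y4
  by_cases hne : cum m (i + 1) = cum m (i' + 1)
  · refine eq_of_cum_eq_min_of_cum_eq_min y1 u1 (c := (angle I (angle I m i') i).degree)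
      (c' := (angle I m i).degree)
      (D := fun t => if (i : ℕ) < t ∧ cum m t = cum m (i + 1) then cum m (i + 1) + 1
        else cum m t) (fun t => (y4 t).trans ?_) u4
    have m1 : t ≤ (i' : ℕ) → cum m t ≤ cum m (i' + 1) := fun h => cum_mono m (by omega)
    have m2 : (i : ℕ) < t → cum m (i + 1) ≤ cum m t := fun h => cum_mono m h
    have := v4 t
    split_ifs at this ⊢ <;> omega
  · have h0 := u4 (i' + 1)
    rw [if_neg (by omega)] at h0
    have hu : (angle I m i).degree ≤ cum m (i' + 1) := by omega
    refine eq_of_cum_eq_min_of_cum_eq_min y1 u1 (c := (angle I (angle I m i') i).degree)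
      (c' := (angle I m i).degree)
      (D := fun t => if (i' : ℕ) < t ∧ cum m t = cum m (i' + 1) then cum m (i' + 1) + 1
      else if (i : ℕ) < t ∧ cum m t = cum m (i + 1) then cum m (i + 1) + 1 else cum m t)
      (fun t => (y4 t).trans ?_) (fun t => (u4 t).trans ?_)
    · have m1 : t ≤ (i' : ℕ) → cum m t ≤ cum m (i' + 1) := fun h => cum_mono m (by omega)
      have m2 : (i' : ℕ) < t → cum m (i' + 1) ≤ cum m t := fun h => cum_mono m h
      have := v4 t
      split_ifs at this ⊢ <;> omega
    · split_ifs <;> omega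

end Iterate

/-! ### The differential squares to zero -/

section Signs

variable {n d : ℕ}

theorem pos_erase {F : Finset (Fin n × Fin d)} {p : Fin n × Fin d} (hp : p ∈ F)
    (s : Fin n × Fin d) : pos (F.erase p) s + (if p.1 ≤ s.1 then 1 else 0) = pos F s := by
  rw [pos, pos, Finset.filter_erase]
  split_ifs with h
  · exact Finset.card_erase_add_one (Finset.mem_filter.2 ⟨hp, h⟩)
  · rw [Finset.erase_eq_of_notMem (by simp [h]), add_zero]

/-- Removing the element with the smaller first component shifts the position of the other by one,
while the opposite removal shifts nothing. -/
theorem sign_erase_comm {F : Finset (Fin n × Fin d)} {p s : Fin n × Fin d} (hp : p ∈ F)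
    (hs : s ∈ F) (hps : p.1 ≠ s.1) :
    ((-1 : ℤ) ^ pos F p * (-1) ^ pos (F.erase p) s)
      = -((-1) ^ pos F s * (-1) ^ pos (F.erase s) p) := by
  rw [← pos_erase hs p, ← pos_erase hp s]
  rcases lt_or_gt_of_ne hps with h | h
  · rw [if_neg (not_le.2 h), if_pos h.le, pow_succ]
    ring
  · rw [if_pos h.le, if_neg (not_le.2 h), pow_succ]
    ring

end Signs

section Square

variable {k : Type u} [Field k] {n d : ℕ} {I : Ideal (MvPolynomial (Fin n) k)}
  {m : Fin n →₀ ℕ} {F : Finset (Fin n × Fin d)}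

theorem Admissible.fst_injOn (h : Admissible I F m) {p s : Fin n × Fin d} (hp : p ∈ F)
    (hs : s ∈ F) (hps : p.1 = s.1) : p = s := by
  rw [admissible_iff] at h
  refine Prod.ext hps (Fin.ext ?_)
  rw [(h.2 p hp).2, (h.2 s hs).2, hps]

theorem Admissible.mono (h : Admissible I F m) {F' : Finset (Fin n × Fin d)} (hF : F' ⊆ F) :
    Admissible I F' m :=
  ⟨h.1, fun p hp => h.2 p (hF hp)⟩

/-- The multidegree of `e(F, b-pol(m))`. -/
def edeg (d : ℕ) (F : Finset (Fin n × Fin d)) (m : Fin n →₀ ℕ) : Fin n × Fin d →₀ ℕ :=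
  bpol d m + ∑ p ∈ F, Finsupp.single p 1

theorem edeg_erase_add (m : Fin n →₀ ℕ) {p : Fin n × Fin d} (hp : p ∈ F) :
    edeg d (F.erase p) m + Finsupp.single p 1 = edeg d F m := by
  rw [edeg, edeg, add_assoc, Finset.sum_erase_add _ _ hp]

theorem IsBorelFixed.edeg_erase_angle_add (hB : IsBorelFixed I) (h : Admissible I F m)
    {p : Fin n × Fin d} (hp : p ∈ F) :
    edeg d (F.erase p) (angle I m p.1) +
      (Finsupp.single p 1 + bpol d m - bpol d (angle I m p.1)) = edeg d F m := by
  rw [admissible_iff] at h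
  have hle := hB.bpol_angle_le h.1 (h.2 p hp).1 (h.2 p hp).2
  rw [edeg, edeg, add_right_comm, add_tsub_cancel_of_le hle, ← Finset.sum_erase_add _ _ hp]
  abel

/-- The multiple of `e(F, b-pol(m))` of degree `D`. -/
def ehom (I : Ideal (MvPolynomial (Fin n) k)) (D : Fin n × Fin d →₀ ℕ) (q : ℕ)
    (F : Finset (Fin n × Fin d)) (m : Fin n →₀ ℕ) : P I d (q + 1) :=
  (monomial (D - edeg d F m) (1 : k) : MvPolynomial (Fin n × Fin d) k) • e I d q F m

theorem e_eq_zero {q : ℕ} (h : ¬ Admissible I F m) : e I d q F m = 0 := by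
  rw [e, dif_neg (fun hF => h hF.1)]

/-- The admissible pair `(F, b-pol(m))` as an index of a basis element of `P̃_{q+1}`. -/
def pidx {q : ℕ} (h : Admissible I F m) (hq : F.card = q) : PIdx I d (q + 1) :=
  (⟨(F, m), h, hq⟩ : A I d q)

theorem exists_eq_pidx {q : ℕ} (x : PIdx I d (q + 1)) :
    ∃ (F : Finset (Fin n × Fin d)) (m : Fin n →₀ ℕ) (h : Admissible I F m) (hq : F.card = q),
      x = pidx h hq :=
  ⟨x.1.1, x.1.2, x.2.1, x.2.2, rfl⟩

theorem e_of_admissible {q : ℕ} (h : Admissible I F m) (hq : F.card = q) :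
    e I d q F m = Finsupp.single (pidx h hq) 1 := by
  rw [e, dif_pos ⟨h, hq⟩]
  rfl

theorem diff_single {q : ℕ} (x : PIdx I d (q + 1)) :
    diff I d q (Finsupp.single x 1) = dBasis I d q x := by
  rw [diff, Finsupp.linearCombination_single, one_smul]

theorem ehom_eq_zero {q : ℕ} {D : Fin n × Fin d →₀ ℕ} (h : ¬ Admissible I F m) :
    ehom I D q F m = 0 := by
  rw [ehom, e_eq_zero h, smul_zero]

/-- The restriction to `B(F, m)` disappears because `e` is zero on pairs that are not admissible, so
both sums run over `F`. -/
theorem diff_e {q : ℕ} (h : Admissible I F m) (hq : F.card = q + 1) :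
    diff I d (q + 1) (e I d (q + 1) F m) = ∑ p ∈ F, ((-1 : ℤ) ^ pos F p) •
      ((X p : MvPolynomial (Fin n × Fin d) k) • e I d q (F.erase p) m -
        (monomial (Finsupp.single p 1 + bpol d m - bpol d (angle I m p.1)) (1 : k) :
          MvPolynomial (Fin n × Fin d) k) • e I d q (F.erase p) (angle I m p.1)) := by
  classical
  rw [e_of_admissible h hq, diff_single, pidx, dBasis]
  rw [Finset.sum_filter, ← Finset.sum_sub_distrib]
  refine Finset.sum_congr (by congr!) fun p _ => ?_
  have hz : ∀ (f : MvPolynomial (Fin n × Fin d) k) (x : P I d (q + 1)),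
      ((-1) ^ pos F p * f) • x = ((-1 : ℤ) ^ pos F p) • (f • x) := by
    intro f x
    rw [mul_smul]
    rcases neg_one_pow_eq_or ℤ (pos F p) with h1 | h1 <;>
      rcases Nat.even_or_odd (pos F p) with h2 | h2 <;> simp [h2.neg_one_pow]
  rw [hz, smul_sub]
  split_ifs with ha
  · rw [hz]
  · rw [e_eq_zero (F := F.erase p) (m := angle I m p.1), smul_zero, smul_zero]
    exact ha

theorem monomial_tsub_mul {σ : Type*} {A B D s : σ →₀ ℕ} (h : A + s = B) (hB : B ≤ D) :
    (monomial (D - B) (1 : k) : MvPolynomial σ k) * monomial s 1 = monomial (D - A) 1 := by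
  rw [monomial_mul, one_mul]
  congr 1
  rw [← h, ← tsub_tsub, tsub_add_cancel_of_le]
  exact le_tsub_of_add_le_left (h ▸ hB)

/-- Homogeneity of the differential turns every coefficient into the complementary monomial of
degree `D`, leaving only signs. The bound `hD` keeps the truncated subtraction of exponents honest.
-/
theorem IsBorelFixed.diff_ehom (hB : IsBorelFixed I) {q : ℕ} {D : Fin n × Fin d →₀ ℕ}
    (h : Admissible I F m) (hq : F.card = q + 1) (hD : edeg d F m ≤ D) :
    diff I d (q + 1) (ehom I D (q + 1) F m) = ∑ p ∈ F, ((-1 : ℤ) ^ pos F p) •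
      (ehom I D q (F.erase p) m - ehom I D q (F.erase p) (angle I m p.1)) := by
  rw [ehom, map_smul, diff_e h hq, Finset.smul_sum]
  refine Finset.sum_congr rfl fun p hp => ?_
  rw [smul_comm, smul_sub, smul_smul, smul_smul, ehom, ehom]
  congr 3
  · exact monomial_tsub_mul (edeg_erase_add m hp) hD
  · exact monomial_tsub_mul (hB.edeg_erase_angle_add h hp) hD

open Classical in
/-- The terms of `∂²e(F, b-pol(m))` for two elements of `F` cancel up to sign. -/
theorem IsBorelFixed.terms_comm (hB : IsBorelFixed I) (h : Admissible I F m)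
    {M : Type*} [AddCommGroup M] {p s : Fin n × Fin d} (hp : p ∈ F) (hs : s ∈ F) (hps : p.1 < s.1)
    (Y : (Fin n →₀ ℕ) → M) (hY : ∀ x, ¬ Admissible I ((F.erase p).erase s) x → Y x = 0) :
    (Y m - Y (angle I m s.1)) - (if Admissible I (F.erase p) (angle I m p.1) then
        Y (angle I m p.1) - Y (angle I (angle I m p.1) s.1) else 0)
      = (Y m - Y (angle I m p.1)) - (if Admissible I (F.erase s) (angle I m s.1) then
        Y (angle I m s.1) - Y (angle I (angle I m s.1) p.1) else 0) := by
  have h' := admissible_iff.1 h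
  obtain ⟨hm, hv⟩ := h'
  obtain ⟨hp1, hp2⟩ := hv p hp
  obtain ⟨hs1, hs2⟩ := hv s hs
  have hpsne : p ≠ s := fun h => hps.ne (congrArg Prod.fst h)
  obtain ⟨u1, -⟩ := hB.angle_spec hm hp1
  obtain ⟨v1, -⟩ := hB.angle_spec hm hs1
  obtain ⟨c1, c2⟩ := hB.cum_angle_of_lt hm hps hs1
  have hmem : ∀ {r}, r ∈ (F.erase p).erase s → r ∈ F := fun hr =>
    Finset.mem_of_mem_erase (Finset.mem_of_mem_erase hr)
  -- admissibility of `(F.erase s, m_{⟨s⟩})` only concerns the elements of `F` other than `p`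
  have hv_adm : (∀ r ∈ (F.erase p).erase s, cum (angle I m s.1) (r.1 + 1) <
      (angle I m s.1).degree ∧ (r.2 : ℕ) = cum (angle I m s.1) (r.1 + 1)) →
      Admissible I (F.erase s) (angle I m s.1) := by
    intro hr
    refine admissible_iff.2 ⟨v1, fun r hrF => ?_⟩
    by_cases hrp : r = p
    · subst hrp
      omega
    · refine hr r ?_
      rw [Finset.erase_right_comm]
      exact Finset.mem_erase.2 ⟨hrp, hrF⟩
  have hYv : Y (angle I m s.1) = if Admissible I (F.erase s) (angle I m s.1) then
      Y (angle I m s.1) else 0 := by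
    split_ifs with hadm
    · rfl
    · exact hY _ fun h0 => hadm (hv_adm (admissible_iff.1 h0).2)
  have hYw : Y (angle I (angle I m s.1) p.1) =
      if Admissible I (F.erase s) (angle I m s.1) then
        Y (angle I (angle I m s.1) p.1) else 0 := by
    split_ifs with hadm
    · rfl
    · refine hY _ fun h0 => hadm (hv_adm fun r hr => ?_)
      exact hB.valid_of_valid_angle_angle hm hs1 (by omega) (hv r (hmem hr)).2
        ((admissible_iff.1 h0).2 r hr)
  -- If `s` stays valid for `angle I m p.1`, the two `angle`s commute, and any lack of admissibility
  -- kills both terms. If not, `(F.erase p, angle I m p.1)` is not admissible, and the iterated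
  -- `angle` on the right equals `angle I m p.1`.
  have key : Y (angle I m p.1) - (if Admissible I (F.erase p) (angle I m p.1) then
      Y (angle I m p.1) - Y (angle I (angle I m p.1) s.1) else 0)
      = Y (angle I (angle I m s.1) p.1) := by
    by_cases hval : cum (angle I m p.1) (s.1 + 1) < (angle I m p.1).degree ∧
        cum (angle I m p.1) (s.1 + 1) = cum m (s.1 + 1)
    · have hcomm := hB.angle_angle_comm hm hps hs1 hval.1 hval.2
      have hu_adm : (∀ r ∈ (F.erase p).erase s, cum (angle I m p.1) (r.1 + 1) <
          (angle I m p.1).degree ∧ (r.2 : ℕ) = cum (angle I m p.1) (r.1 + 1)) →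
          Admissible I (F.erase p) (angle I m p.1) := by
        intro hr
        refine admissible_iff.2 ⟨u1, fun r hrF => ?_⟩
        by_cases hrs : r = s
        · subst hrs
          omega
        · exact hr r (Finset.mem_erase.2 ⟨hrs, hrF⟩)
      split_ifs with hadm
      · rw [hcomm, sub_sub_cancel]
      · rw [hY (angle I m p.1) fun h0 => hadm (hu_adm (admissible_iff.1 h0).2), sub_zero,
          ← hcomm, hY]
        refine fun h0 => hadm (hu_adm fun r hr => ?_)
        exact hB.valid_of_valid_angle_angle hm hp1 hval.1 (hv r (hmem hr)).2
          ((admissible_iff.1 h0).2 r hr)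
    · rw [hB.angle_angle_eq_angle hm hps hs1 hval, if_neg, sub_zero]
      intro hadm
      have := (admissible_iff.1 hadm).2 s (Finset.mem_erase.2 ⟨hpsne.symm, hs⟩)
      exact hval (by omega)
  have hif : (if Admissible I (F.erase s) (angle I m s.1) then
        Y (angle I m s.1) - Y (angle I (angle I m s.1) p.1) else 0)
      = Y (angle I m s.1) - Y (angle I (angle I m s.1) p.1) := by
    split_ifs at hYv hYw ⊢ with hadm
    · rfl
    · rw [hYv, hYw, sub_zero]
  rw [hif, ← key]
  abel

theorem IsBorelFixed.diff_diff_succ (hB : IsBorelFixed I) (q : ℕ)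
    (x : PIdx I d (q + 3)) :
    diff I d (q + 1) (diff I d (q + 2) (Finsupp.single x 1)) = 0 := by
  classical
  obtain ⟨F, m, h, hq, rfl⟩ := exists_eq_pidx x
  set D := edeg d F m with hD
  have hx : (Finsupp.single (pidx h hq) 1 : P I d (q + 3))
      = ehom I D (q + 2) F m := by
    rw [ehom, e_of_admissible h hq, tsub_self]
    exact (one_smul _ _).symm
  have hcard : ∀ p ∈ F, (F.erase p).card = q + 1 := fun p hp => by
    rw [Finset.card_erase_of_mem hp, hq]; rfl
  have hdeg1 : ∀ p ∈ F, edeg d (F.erase p) m ≤ D := fun p hp =>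
    le_self_add.trans (edeg_erase_add m hp).le
  have hdeg2 : ∀ p ∈ F, edeg d (F.erase p) (angle I m p.1) ≤ D := fun p hp =>
    le_self_add.trans (hB.edeg_erase_angle_add h hp).le
  rw [hx, hB.diff_ehom h hq le_rfl, map_sum]
  -- The unsigned contribution of removing `p` first and then `s`; it is symmetric, so swapping `p`
  -- and `s` pairs off terms of opposite sign.
  set Φ : Fin n × Fin d → Fin n × Fin d → P I d (q + 1) := fun p s =>
    (ehom I D q ((F.erase p).erase s) m - ehom I D q ((F.erase p).erase s) (angle I m s.1))
    - (if Admissible I (F.erase p) (angle I m p.1) then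
        ehom I D q ((F.erase p).erase s) (angle I m p.1)
        - ehom I D q ((F.erase p).erase s) (angle I (angle I m p.1) s.1) else 0) with hΦ
  have hΦcomm : ∀ p ∈ F, ∀ s ∈ F, p ≠ s → Φ p s = Φ s p := by
    have hlt : ∀ p ∈ F, ∀ s ∈ F, p.1 < s.1 → Φ p s = Φ s p := by
      intro p hp s hs hps
      simp only [hΦ]
      rw [hB.terms_comm h hp hs hps (fun y => ehom I D q ((F.erase p).erase s) y)
        (fun y hy => ehom_eq_zero hy), Finset.erase_right_comm]
    intro p hp s hs hps
    rcases lt_trichotomy p.1 s.1 with h1 | h1 | h1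
    · exact hlt p hp s hs h1
    · exact absurd (h.fst_injOn hp hs h1) hps
    · exact (hlt s hs p hp h1).symm
  have hsum : ∀ p ∈ F, diff I d (q + 1) (((-1 : ℤ) ^ pos F p) •
      (ehom I D (q + 1) (F.erase p) m - ehom I D (q + 1) (F.erase p) (angle I m p.1)))
      = ∑ s ∈ F.erase p, ((-1 : ℤ) ^ pos F p * (-1) ^ pos (F.erase p) s) • Φ p s := by
    intro p hp
    have hsecond : diff I d (q + 1) (ehom I D (q + 1) (F.erase p) (angle I m p.1))
        = ∑ s ∈ F.erase p, ((-1 : ℤ) ^ pos (F.erase p) s) •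
          (if Admissible I (F.erase p) (angle I m p.1) then
            ehom I D q ((F.erase p).erase s) (angle I m p.1)
            - ehom I D q ((F.erase p).erase s) (angle I (angle I m p.1) s.1) else 0) := by
      by_cases hadm : Admissible I (F.erase p) (angle I m p.1)
      · rw [hB.diff_ehom hadm (hcard p hp) (hdeg2 p hp)]
        simp only [if_pos hadm]
      · rw [ehom_eq_zero hadm, map_zero]
        simp only [if_neg hadm, smul_zero, Finset.sum_const_zero]
    rw [map_zsmul, map_sub, hsecond, hB.diff_ehom (h.mono (Finset.erase_subset p F)) (hcard p hp)
      (hdeg1 p hp), ← Finset.sum_sub_distrib, Finset.smul_sum]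
    refine Finset.sum_congr rfl fun s _ => ?_
    simp only [hΦ, smul_sub, mul_smul]
  rw [Finset.sum_congr rfl hsum, Finset.sum_sigma']
  refine Finset.sum_involution (fun x _ => ⟨x.2, x.1⟩) ?_ ?_ ?_ ?_
  · rintro ⟨p, s⟩ hx
    simp only [Finset.mem_sigma, Finset.mem_erase] at hx
    obtain ⟨hp, hsp, hs⟩ := hx
    simp only
    rw [sign_erase_comm hp hs fun h1 => hsp (h.fst_injOn hp hs h1).symm,
      hΦcomm p hp s hs (Ne.symm hsp), neg_smul, neg_add_cancel]
  · rintro ⟨p, s⟩ hx _ heq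
    simp only [Finset.mem_sigma, Finset.mem_erase] at hx
    simp only [Sigma.mk.injEq, heq_eq_eq] at heq
    exact hx.2.1 heq.1
  · rintro ⟨p, s⟩ hx
    simp only [Finset.mem_sigma, Finset.mem_erase] at hx ⊢
    exact ⟨hx.2.2, hx.2.1.symm, hx.1⟩
  · rintro ⟨p, s⟩ _
    rfl

/-- The index of the basis element of `P̃_0`. -/
def pidxZero (I : Ideal (MvPolynomial (Fin n) k)) (d : ℕ) : PIdx I d 0 := ()

theorem diff_zero_e (h : Admissible I F m) (hq : F.card = 0) :
    diff I d 0 (e I d 0 F m) = Finsupp.single (pidxZero I d) (monomial (bpol d m) 1) := by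
  rw [e_of_admissible h hq, diff_single, pidx, dBasis]
  rfl

theorem IsBorelFixed.diff_diff_zero (hB : IsBorelFixed I) (x : PIdx I d 2) :
    diff I d 0 (diff I d 1 (Finsupp.single x 1)) = 0 := by
  classical
  obtain ⟨F, m, h, hq, rfl⟩ := exists_eq_pidx x
  rw [← e_of_admissible (q := 1) h hq, diff_e h hq, map_sum]
  refine Finset.sum_eq_zero fun p hp => ?_
  have hc : (F.erase p).card = 0 := by rw [Finset.card_erase_of_mem hp, hq]
  have h' := admissible_iff.1 h
  have h1 : Admissible I (F.erase p) (angle I m p.1) := by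
    rw [Finset.card_eq_zero] at hc
    rw [hc, admissible_iff]
    exact ⟨(hB.angle_spec h'.1 (h'.2 p hp).1).1, by simp⟩
  have hle := hB.bpol_angle_le h'.1 (h'.2 p hp).1 (h'.2 p hp).2
  rw [map_zsmul, map_sub, map_smul, map_smul, diff_zero_e (h.mono (Finset.erase_subset p F)) hc,
    diff_zero_e h1 hc, Finsupp.smul_single, Finsupp.smul_single, smul_eq_mul, smul_eq_mul,
    monomial_mul, X, monomial_mul, tsub_add_cancel_of_le hle, sub_self, smul_zero]

theorem IsBorelFixed.diff_diff (hB : IsBorelFixed I) (q : ℕ) (x : PIdx I d (q + 2)) :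
    diff I d q (diff I d (q + 1) (Finsupp.single x 1)) = 0 := by
  cases q with
  | zero => exact hB.diff_diff_zero x
  | succ q => exact hB.diff_diff_succ q x

end Square

/-! ### Exactness of the Koszul complex of a set of variables -/

section Koszul

variable {k : Type u} [Field k] {σ : Type v} {ι : Type w} [DecidableEq ι]

theorem sub_X_mul_divMonomial_mem_supported (x : σ) (f : MvPolynomial σ k) :
    f - X x * f.divMonomial (Finsupp.single x 1) ∈ supported k ({x}ᶜ : Set σ) := by
  classical
  have h := divMonomial_add_modMonomial_single f x
  have h' : f - X x * f.divMonomial (Finsupp.single x 1) = f.modMonomial (Finsupp.single x 1) :=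
    sub_eq_of_eq_add' h.symm
  rw [h', mem_supported]
  intro z hz hzx
  rw [Set.mem_singleton_iff] at hzx
  subst hzx
  obtain ⟨s, hs, hzs⟩ := (mem_vars_iff_mem_support _).1 hz
  rw [mem_support_iff] at hs
  refine hs (coeff_modMonomial_of_le f ?_)
  rw [Finsupp.single_le_iff]
  exact Nat.one_le_iff_ne_zero.2 (Finsupp.mem_support_iff.1 hzs)

theorem eq_zero_of_X_mul_mem_supported {x : σ} {f : MvPolynomial σ k}
    (h : X x * f ∈ supported k ({x}ᶜ : Set σ)) : f = 0 := by
  classical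
  by_contra hf
  obtain ⟨s, hs⟩ := ne_zero_iff.1 hf
  rw [mem_supported] at h
  refine h (a := x) ?_ rfl
  refine (mem_vars_iff_mem_support _).2 ⟨s + Finsupp.single x 1, ?_, by simp⟩
  rw [mem_support_iff, add_comm, coeff_X_mul]
  exact hs

/-- The Koszul differential for the variables `X (y p)`, `p ∈ V`, with signs `ε`, on families
of coefficients indexed by finite sets. -/
def koszul (y : ι → σ) (ε : Finset ι → ι → ℤ) (V : Finset ι) (c : Finset ι → MvPolynomial σ k)
    (S : Finset ι) : MvPolynomial σ k :=
  ∑ p ∈ V \ S, ((ε (insert p S) p : ℤ) : MvPolynomial σ k) * (X (y p) * c (insert p S))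

theorem koszul_koszul {y : ι → σ} {ε : Finset ι → ι → ℤ} {V : Finset ι}
    (hε : ∀ S ⊆ V, ∀ p ∈ S, ∀ s ∈ S, p ≠ s →
      ε S p * ε (S.erase p) s = -(ε S s * ε (S.erase s) p))
    (c : Finset ι → MvPolynomial σ k) {S : Finset ι} (hS : S ⊆ V) :
    koszul y ε V (koszul y ε V c) S = 0 := by
  simp only [koszul, Finset.mul_sum]
  rw [Finset.sum_sigma']
  refine Finset.sum_involution (fun x _ => ⟨x.2, x.1⟩) ?_ ?_ ?_ ?_
  · rintro ⟨p, s⟩ hx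
    simp only [Finset.mem_sigma, Finset.mem_sdiff, Finset.mem_insert, not_or] at hx
    obtain ⟨⟨hp, hpS⟩, hs, hsp, hsS⟩ := hx
    have h := hε (insert s (insert p S)) (by grind) s (by simp) p (by simp) hsp
    have e1 : (insert s (insert p S)).erase s = insert p S := by grind
    have e2 : (insert s (insert p S)).erase p = insert s S := by grind
    rw [e1, e2] at h
    have h' := congrArg (fun z : ℤ => (z : MvPolynomial σ k)) h
    push_cast at h'
    simp only
    rw [Finset.insert_comm p s S]
    linear_combination (X (y p) * (X (y s) * c (insert s (insert p S)))) * h'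
  · rintro ⟨p, s⟩ hx _ heq
    simp only [Finset.mem_sigma, Finset.mem_sdiff, Finset.mem_insert, not_or] at hx
    simp only [Sigma.mk.injEq, heq_eq_eq] at heq
    exact hx.2.2.1 heq.1
  · rintro ⟨p, s⟩ hx
    simp only [Finset.mem_sigma, Finset.mem_sdiff, Finset.mem_insert, not_or] at hx ⊢
    exact ⟨⟨hx.2.1, hx.2.2.2⟩, hx.1.1, Ne.symm hx.2.2.1, hx.1.2⟩
  · rintro ⟨p, s⟩ _
    rfl

theorem koszul_insert {y : ι → σ} {ε : Finset ι → ι → ℤ} {V : Finset ι} {v : ι} (hv : v ∉ V)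
    (c : Finset ι → MvPolynomial σ k) {S : Finset ι} (hS : v ∉ S) :
    koszul y ε (insert v V) c S
      = ((ε (insert v S) v : ℤ) : MvPolynomial σ k) * (X (y v) * c (insert v S))
        + koszul y ε V c S := by
  rw [koszul, Finset.insert_sdiff_of_notMem _ hS, Finset.sum_insert (by simp [hv]), koszul]

/-- All homological degrees are treated at once, so `h0` excludes the only degree with homology.
When a variable is added to `V`, division with remainder by it reduces to a cycle supported on
subsets of the old `V`. -/
theorem exists_eq_koszul {y : ι → σ} {ε : Finset ι → ι → ℤ} {V : Finset ι}
    (hy : Set.InjOn y V) (hε1 : ∀ S p, ε S p * ε S p = 1)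
    (hε : ∀ S ⊆ V, ∀ p ∈ S, ∀ s ∈ S, p ≠ s →
      ε S p * ε (S.erase p) s = -(ε S s * ε (S.erase s) p))
    (c : Finset ι → MvPolynomial σ k) (h0 : c ∅ = 0) (hc : ∀ S ⊆ V, koszul y ε V c S = 0) :
    ∃ w : Finset ι → MvPolynomial σ k, ∀ S ⊆ V, c S = koszul y ε V w S := by
  induction V using Finset.induction_on generalizing c with
  | empty =>
    refine ⟨0, fun S hS => ?_⟩
    rw [Finset.subset_empty.1 hS, h0, koszul]
    simp
  | insert v V hv ih =>
    have hε1' : ∀ S p, ((ε S p : ℤ) : MvPolynomial σ k) * ((ε S p : ℤ) : MvPolynomial σ k) = 1 := by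
      intro S p
      exact_mod_cast congrArg (fun z : ℤ => (z : MvPolynomial σ k)) (hε1 S p)
    -- Chosen so that subtracting its boundary removes from `c S`, for `v ∉ S`, all monomials
    -- divisible by `X (y v)`.
    set w₁ : Finset ι → MvPolynomial σ k := fun S => if v ∈ S then
      ((ε S v : ℤ) : MvPolynomial σ k) * (c (S.erase v)).divMonomial (Finsupp.single (y v) 1) else 0
      with hw₁
    set c' : Finset ι → MvPolynomial σ k := fun S => c S - koszul y ε (insert v V) w₁ S with hc'
    have hw1v : ∀ S, v ∉ S → koszul y ε V w₁ S = 0 := by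
      intro S hS
      refine Finset.sum_eq_zero fun p hp => ?_
      have : v ∉ insert p S := by grind
      rw [hw₁]
      simp only [if_neg this, mul_zero]
    have hc'v : ∀ S, v ∉ S → c' S = c S - X (y v) * (c S).divMonomial (Finsupp.single (y v) 1) := by
      intro S hS
      simp only [hc']
      rw [koszul_insert hv _ hS, hw1v S hS, add_zero, hw₁]
      simp only [Finset.mem_insert_self, if_true, Finset.erase_insert hS]
      linear_combination (-X (y v) * (c S).divMonomial (Finsupp.single (y v) 1)) *
        hε1' (insert v S) v
    have hc'0 : c' ∅ = 0 := by
      rw [hc'v ∅ (by simp), h0, zero_divMonomial, mul_zero, sub_zero]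
    have hcyc : ∀ S ⊆ insert v V, koszul y ε (insert v V) c' S = 0 := by
      intro S hS
      have h1 : koszul y ε (insert v V) c' S = koszul y ε (insert v V) c S
          - koszul y ε (insert v V) (koszul y ε (insert v V) w₁) S := by
        simp only [hc']
        rw [koszul, koszul, koszul, ← Finset.sum_sub_distrib]
        exact Finset.sum_congr rfl fun p _ => by ring
      rw [h1, hc S hS, koszul_koszul hε _ hS, sub_zero]
    -- The cycle condition at `S` equates `X (y v) * c' (insert v S)`, up to sign, with an
    -- expression free of `X (y v)`; injectivity of `y` enters here.
    have hvan : ∀ S ⊆ V, c' (insert v S) = 0 := by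
      intro S hS
      have hvS : v ∉ S := fun h => hv (hS h)
      have h1 := hcyc S (hS.trans (Finset.subset_insert _ _))
      rw [koszul_insert hv _ hvS] at h1
      have h2 : X (y v) * c' (insert v S)
          = -(((ε (insert v S) v : ℤ) : MvPolynomial σ k) * koszul y ε V c' S) := by
        linear_combination ((ε (insert v S) v : ℤ) : MvPolynomial σ k) * h1
          - X (y v) * c' (insert v S) * hε1' (insert v S) v
      refine eq_zero_of_X_mul_mem_supported (x := y v) ?_
      rw [h2]
      refine neg_mem (mul_mem (intCast_mem _ _) (sum_mem fun p hp => ?_))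
      rw [Finset.mem_sdiff] at hp
      refine mul_mem (intCast_mem _ _) (mul_mem ?_ ?_)
      · rw [X_mem_supported]
        intro hyp
        have : p = v := hy (by simp [hp.1]) (by simp) hyp
        exact hv (this ▸ hp.1)
      · rw [hc'v _ (by grind)]
        exact sub_X_mul_divMonomial_mem_supported _ _
    obtain ⟨w₂, hw₂⟩ := ih (hy.mono (by simp))
      (fun S hS => hε S (hS.trans (Finset.subset_insert _ _))) c' hc'0 (fun S hS => by
        have h1 := hcyc S (hS.trans (Finset.subset_insert _ _))
        rwa [koszul_insert hv _ (fun h => hv (hS h)), hvan S hS, mul_zero, mul_zero,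
          zero_add] at h1)
    refine ⟨fun S => w₁ S + if v ∈ S then 0 else w₂ S, fun S hS => ?_⟩
    have hadd : koszul y ε (insert v V) (fun S => w₁ S + if v ∈ S then 0 else w₂ S) S
        = koszul y ε (insert v V) w₁ S
          + koszul y ε (insert v V) (fun S => if v ∈ S then 0 else w₂ S) S := by
      rw [koszul, koszul, koszul, ← Finset.sum_add_distrib]
      exact Finset.sum_congr rfl fun p _ => by ring
    have hkey : c' S = koszul y ε (insert v V) (fun S => if v ∈ S then 0 else w₂ S) S := by
      by_cases hvS : v ∈ S
      · have h1 := hvan (S.erase v) (by grind)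
        rw [Finset.insert_erase hvS] at h1
        rw [h1, koszul]
        refine (Finset.sum_eq_zero fun p _ => ?_).symm
        simp [hvS]
      · rw [koszul_insert hv _ hvS, hw₂ S (by grind)]
        simp only [Finset.mem_insert_self, if_true, mul_zero, zero_add]
        refine Finset.sum_congr rfl fun p hp => ?_
        have hvp : v ∉ insert p S := by
          rw [Finset.mem_sdiff] at hp
          rw [Finset.mem_insert, not_or]
          exact ⟨fun h => hv (h ▸ hp.1), hvS⟩
        simp only [if_neg hvp]
    rw [hadd, ← hkey]
    simp only [hc']
    ring

end Koszul

/-! ### The lexicographic order on the generators -/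

section Rank

variable {k : Type u} [Field k] {n d : ℕ} {I : Ideal (MvPolynomial (Fin n) k)}

theorem finite_G (hd : ∀ m ∈ G I, m.degree ≤ d) : (G I).Finite := by
  refine (Set.finite_Iic (Finsupp.equivFunOnFinite.symm fun _ : Fin n => d)).subset fun m hm i => ?_
  exact (Finsupp.le_degree i m).trans (hd m hm)

/-- The number of generators that are lexicographically larger than `m`. -/
def rank (I : Ideal (MvPolynomial (Fin n) k)) (m : Fin n →₀ ℕ) : ℕ :=
  Set.ncard {u | u ∈ G I ∧ toLex m < toLex u}

theorem rank_lt_rank (hG : (G I).Finite) {m u : Fin n →₀ ℕ} (hu : u ∈ G I)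
    (h : toLex m < toLex u) : rank I u < rank I m := by
  refine Set.ncard_lt_ncard ?_ (hG.subset fun x hx => hx.1)
  refine Set.ssubset_iff_exists.2 ⟨fun x hx => ⟨hx.1, h.trans hx.2⟩, u, ⟨hu, h⟩, fun hx => ?_⟩
  exact lt_irrefl _ hx.2

theorem toLex_lt_of_rank_lt (hG : (G I).Finite) {m u : Fin n →₀ ℕ} (hm : m ∈ G I)
    (h : rank I u < rank I m) : toLex m < toLex u := by
  rcases lt_trichotomy (toLex m) (toLex u) with h1 | h1 | h1
  · exact h1
  · rw [toLex_inj.1 h1] at h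
    exact absurd h (lt_irrefl _)
  · exact absurd (rank_lt_rank hG hm h1) (not_lt.2 h.le)

theorem eq_of_rank_eq (hG : (G I).Finite) {m u : Fin n →₀ ℕ} (hm : m ∈ G I) (hu : u ∈ G I)
    (h : rank I m = rank I u) : m = u := by
  rcases lt_trichotomy (toLex m) (toLex u) with h1 | h1 | h1
  · exact absurd (rank_lt_rank hG hu h1) (by omega)
  · exact toLex_inj.1 h1
  · exact absurd (rank_lt_rank hG hm h1) (by omega)

theorem rank_lt_ncard (hG : (G I).Finite) {m : Fin n →₀ ℕ} (hm : m ∈ G I) :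
    rank I m < (G I).ncard := by
  refine Set.ncard_lt_ncard ?_ hG
  refine Set.ssubset_iff_exists.2 ⟨fun x hx => hx.1, m, hm, fun hx => ?_⟩
  exact lt_irrefl _ hx.2

theorem exists_cum_lt_of_toLex_lt {m u : Fin n →₀ ℕ} (h : toLex m < toLex u) :
    ∃ i : Fin n, (∀ t ≤ (i : ℕ), cum m t = cum u t) ∧ cum m (i + 1) < cum u (i + 1) ∧
      ∀ l < i, m l = u l := by
  obtain ⟨i, hi, hlt⟩ := Finsupp.Lex.lt_iff.1 h
  have h1 : ∀ t ≤ (i : ℕ), cum m t = cum u t := by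
    intro t ht
    refine Finset.sum_congr rfl fun l hl => hi l ?_
    rw [Finset.mem_filter] at hl
    exact Fin.lt_def.2 (hl.2.trans_le ht)
  refine ⟨i, h1, ?_, hi⟩
  have hlt' : m i < u i := hlt
  rw [cum_succ, cum_succ, h1 i le_rfl]
  omega

/-- The exponents before `i` are unchanged and that of `x_i` grows. This makes the differential
triangular for the filtration by rank. -/
theorem IsBorelFixed.toLex_lt_angle (hB : IsBorelFixed I) {m : Fin n →₀ ℕ} (hm : m ∈ G I)
    {i : Fin n} (hi : cum m (i + 1) < m.degree) : toLex m < toLex (angle I m i) := by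
  obtain ⟨-, h1, -, h2⟩ := hB.angle_spec hm hi
  have h3 : ∀ t ≤ (i : ℕ), cum (angle I m i) t = cum m t := by
    intro t ht
    have : cum m t ≤ cum m (i + 1) := cum_mono m (by omega)
    rw [h2, if_neg (by omega)]
    omega
  refine Finsupp.Lex.lt_iff.2 ⟨i, fun l hl => ?_, ?_⟩
  · have hl' := Fin.lt_def.1 hl
    have e1 := cum_succ m l
    have e2 := cum_succ (angle I m i) l
    have e3 := h3 (l + 1) (by omega)
    have e4 := h3 l (by omega)
    change m l = angle I m i l
    omega
  · have e1 := cum_succ m i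
    have e2 := cum_succ (angle I m i) i
    have e3 := h2 (i + 1)
    rw [if_pos (by omega)] at e3
    rw [h3 i le_rfl] at e2
    change m i < angle I m i i
    omega

/-- The pairs `(i, j)` that can occur in `F` for an admissible pair `(F, b-pol(m))`. -/
def validSet (d : ℕ) (m : Fin n →₀ ℕ) : Finset (Fin n × Fin d) :=
  Finset.univ.filter fun p => cum m (p.1 + 1) < m.degree ∧ (p.2 : ℕ) = cum m (p.1 + 1)

theorem mem_validSet {m : Fin n →₀ ℕ} {p : Fin n × Fin d} :
    p ∈ validSet d m ↔ cum m (p.1 + 1) < m.degree ∧ (p.2 : ℕ) = cum m (p.1 + 1) := by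
  simp [validSet]

theorem admissible_iff_subset {F : Finset (Fin n × Fin d)} {m : Fin n →₀ ℕ} :
    Admissible I F m ↔ m ∈ G I ∧ F ⊆ validSet d m := by
  rw [admissible_iff, Finset.subset_iff]
  simp only [mem_validSet]

end Rank

/-! ### Colon ideals -/

section Colon

variable {k : Type u} [Field k] {n d : ℕ} {I : Ideal (MvPolynomial (Fin n) k)}
  {a : ℕ → ℕ} {N : ℕ}

/-- The map `(i, j) ↦ i + a_{j-1}` of indices of variables. -/
def phi (hN : ∀ (i : Fin n) (j : Fin d), (i : ℕ) + a j < N) (p : Fin n × Fin d) : Fin N :=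
  ⟨(p.1 : ℕ) + a p.2, hN p.1 p.2⟩

theorem toT_eq_rename (hN : ∀ (i : Fin n) (j : Fin d), (i : ℕ) + a j < N) :
    toT k hN = rename (phi hN) := by
  ext p
  simp [toT, phi]

/-- On valid pairs `j` is a non-decreasing function of `i`, so `i + a j` increases strictly. -/
theorem phi_injOn (ha : Monotone a) (hN : ∀ (i : Fin n) (j : Fin d), (i : ℕ) + a j < N)
    (m : Fin n →₀ ℕ) : Set.InjOn (phi hN) (validSet d m) := by
  have hlt : ∀ p ∈ validSet d m, ∀ q ∈ validSet d m, p.1 < q.1 → phi hN p ≠ phi hN q := by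
    intro p hp q hq hpq h
    have h1 : (p.1 : ℕ) + a p.2 = q.1 + a q.2 := congrArg Fin.val h
    have h2 := Fin.lt_def.1 hpq
    have h3 : a p.2 ≤ a q.2 := by
      refine ha ?_
      rw [(mem_validSet.1 hp).2, (mem_validSet.1 hq).2]
      exact cum_mono m (by omega)
    omega
  intro p hp q hq h
  rcases lt_trichotomy p.1 q.1 with h1 | h1 | h1
  · exact absurd h (hlt p hp q hq h1)
  · refine Prod.ext h1 (Fin.ext ?_)
    rw [(mem_validSet.1 hp).2, (mem_validSet.1 hq).2, h1]
  · exact absurd h.symm (hlt q hq p hp h1)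

theorem mapDomain_apply_eq_sum {σ τ : Type*} [Fintype σ] [DecidableEq τ] (f : σ → τ) (x : σ →₀ ℕ)
    (y : τ) : x.mapDomain f y = ∑ s ∈ Finset.univ.filter (fun s => f s = y), x s := by
  rw [Finsupp.mapDomain, Finsupp.sum_fintype _ _ (by simp), Finsupp.finsetSum_apply,
    Finset.sum_filter]
  simp only [Finsupp.single_apply]

theorem exists_mapDomain_bpol_lt (ha : Monotone a)
    (hN : ∀ (i : Fin n) (j : Fin d), (i : ℕ) + a j < N) {m u : Fin n →₀ ℕ} (hm : m ∈ G I)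
    (hu : u ∈ G I) (hd : m.degree ≤ d) (h : toLex m < toLex u) :
    ∃ p ∈ validSet d m, (bpol d m).mapDomain (phi hN) (phi hN p)
      < (bpol d u).mapDomain (phi hN) (phi hN p) := by
  obtain ⟨i, h1, h2, h3⟩ := exists_cum_lt_of_toLex_lt h
  have hi : cum m (i + 1) < m.degree := by
    by_contra! hc
    have hle : m ≤ u := by
      intro l
      rcases lt_trichotomy l i with hl | hl | hl
      · exact (h3 l hl).le
      · have e1 := cum_succ m i
        have e2 := cum_succ u i
        have e3 := h1 i le_rfl
        subst hl
        omega
      · have hl0 : m l = 0 := by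
          by_contra hl0
          exact absurd ((exists_support_gt_iff m i).1 ⟨l, by simpa using hl0, hl⟩) (by omega)
        omega
    have : m = u := le_antisymm hle (hu.2 hm.1 hle)
    rw [this] at h
    exact lt_irrefl _ h
  -- At the first index `i` where `m` and `u` differ, this variable divides `bpol d u` but not `bpol
  -- d m`. Any other variable `q` in its fibre that divides `bpol d m` also divides `bpol d u`: for
  -- `q.1 ≤ i` the staircases agree far enough, and `q.1 > i` is impossible since then `q.1 + a q.2`
  -- is too large.
  set p : Fin n × Fin d := (i, ⟨cum m (i + 1), by omega⟩) with hp
  refine ⟨p, mem_validSet.2 ⟨hi, rfl⟩, ?_⟩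
  rw [mapDomain_apply_eq_sum, mapDomain_apply_eq_sum]
  refine Finset.sum_lt_sum (fun q hq => ?_) ⟨p, by simp, ?_⟩
  · rw [bpol_apply, bpol_apply]
    split_ifs with hA hC <;> try omega
    refine absurd ?_ hC
    have hq' : (q.1 : ℕ) + a q.2 = i + a (cum m (i + 1)) :=
      congrArg Fin.val (Finset.mem_filter.1 hq).2
    rcases lt_trichotomy (q.1 : ℕ) i with hl | hl | hl
    · rw [← h1 _ hl.le, ← h1 _ hl]
      exact hA
    · rw [hl] at hA ⊢
      rw [← h1 _ le_rfl]
      omega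
    · have e1 : cum m (i + 1) ≤ cum m q.1 := cum_mono m hl
      have e2 : a (cum m (i + 1)) ≤ a q.2 := ha (e1.trans hA.1)
      omega
  · have e1 := h1 i le_rfl
    have e2 := cum_mono m (Nat.le_succ (i : ℕ))
    rw [Nat.succ_eq_add_one] at e2
    rw [bpol_apply, bpol_apply]
    simp only [hp]
    rw [if_neg (by omega), if_pos (by omega)]
    omega

/-- The colon ideal of the generators before `m` by `m` is generated by variables. -/
theorem mem_span_X_of_mul_mem (ha : Monotone a)
    (hN : ∀ (i : Fin n) (j : Fin d), (i : ℕ) + a j < N) {m : Fin n →₀ ℕ} (hm : m ∈ G I)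
    (hd : m.degree ≤ d) {U : Set (Fin n →₀ ℕ)} (hU : ∀ u ∈ U, u ∈ G I ∧ toLex m < toLex u)
    {f : MvPolynomial (Fin N) k}
    (hf : f * monomial ((bpol d m).mapDomain (phi hN)) 1 ∈
      Ideal.span ((fun u => monomial ((bpol d u).mapDomain (phi hN)) (1 : k)) '' U)) :
    f ∈ Ideal.span ((fun p => (X (phi hN p) : MvPolynomial (Fin N) k)) '' (validSet d m)) := by
  have e1 : (fun u => monomial ((bpol d u).mapDomain (phi hN)) (1 : k)) '' U
      = (fun s => monomial s (1 : k)) '' ((fun u => (bpol d u).mapDomain (phi hN)) '' U) := by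
    rw [Set.image_image]
  have e2 : (fun p => (X (phi hN p) : MvPolynomial (Fin N) k)) '' (validSet d m)
      = X '' (phi hN '' (validSet d m)) := by
    rw [Set.image_image]
  rw [e1, mem_ideal_span_monomial_image] at hf
  rw [e2, mem_ideal_span_X_image]
  intro s hs
  obtain ⟨_, ⟨u, hu, rfl⟩, hle⟩ := hf (s + (bpol d m).mapDomain (phi hN)) (by
    rw [mem_support_iff, coeff_mul_monomial, mul_one]
    exact mem_support_iff.1 hs)
  obtain ⟨hu1, hu2⟩ := hU u hu
  obtain ⟨p, hp, hlt⟩ := exists_mapDomain_bpol_lt ha hN hm hu1 hd hu2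
  refine ⟨phi hN p, ⟨p, hp, rfl⟩, ?_⟩
  have h1 := hle (phi hN p)
  rw [Finsupp.add_apply] at h1
  simp only at h1
  omega

end Colon

/-! ### The complex over `T` in coordinates -/

section Coordinates

variable {k : Type u} [Field k] {n d : ℕ} {I : Ideal (MvPolynomial (Fin n) k)}
  {a : ℕ → ℕ} {N : ℕ} (hN : ∀ (i : Fin n) (j : Fin d), (i : ℕ) + a j < N)

/-- Change of coefficients from `S̃` to `T`. -/
def push (q : ℕ) : P I d q →+ (PIdx I d q →₀ MvPolynomial (Fin N) k) :=
  Finsupp.mapRange.addMonoidHom (toT k hN).toRingHom.toAddMonoidHom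

theorem push_apply (q : ℕ) (z : P I d q) (x : PIdx I d q) : push hN q z x = toT k hN (z x) := rfl

theorem push_smul (q : ℕ) (c : MvPolynomial (Fin n × Fin d) k) (z : P I d q) :
    push hN q (c • z) = toT k hN c • push hN q z := by
  ext1 x
  rw [push_apply, Finsupp.smul_apply, Finsupp.smul_apply, push_apply, smul_eq_mul, map_mul,
    smul_eq_mul]

theorem push_single (q : ℕ) (x : PIdx I d q) (c : MvPolynomial (Fin n × Fin d) k) :
    push hN q (Finsupp.single x c) = Finsupp.single x (toT k hN c) :=
  Finsupp.mapRange_single (hf := map_zero _)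

/-- The differential over `T`. -/
def dT (I : Ideal (MvPolynomial (Fin n) k)) (q : ℕ) :
    (PIdx I d (q + 1) →₀ MvPolynomial (Fin N) k) →ₗ[MvPolynomial (Fin N) k]
      (PIdx I d q →₀ MvPolynomial (Fin N) k) :=
  Finsupp.linearCombination _ fun x => push hN q (dBasis I d q x)

theorem dT_push (q : ℕ) (z : P I d (q + 1)) :
    dT hN I q (push hN (q + 1) z) = push hN q (diff I d q z) := by
  induction z using Finsupp.induction_linear with
  | zero => simp only [map_zero]
  | add z z' h h' => simp only [map_add, h, h']
  | single x c =>
    rw [push_single, dT, diff, Finsupp.linearCombination_single, Finsupp.linearCombination_single,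
      push_smul]

theorem IsBorelFixed.dT_dT (hB : IsBorelFixed I) (q : ℕ)
    (z : PIdx I d (q + 2) →₀ MvPolynomial (Fin N) k) : dT hN I q (dT hN I (q + 1) z) = 0 := by
  induction z using Finsupp.induction_linear with
  | zero => simp only [map_zero]
  | add z z' h h' => simp only [map_add, h, h', add_zero]
  | single x c =>
    have h1 : Finsupp.single x c = c • push hN (q + 2) (Finsupp.single x 1) := by
      rw [push_single, map_one, Finsupp.smul_single, smul_eq_mul, mul_one]
    rw [h1, map_smul, map_smul, dT_push, dT_push, hB.diff_diff, map_zero, smul_zero]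

/-- The basis element `e(F, b-pol(m))` over `T`. -/
def eT (I : Ideal (MvPolynomial (Fin n) k)) (q : ℕ) (F : Finset (Fin n × Fin d))
    (m : Fin n →₀ ℕ) : PIdx I d (q + 1) →₀ MvPolynomial (Fin N) k :=
  push hN (q + 1) (e I d q F m)

variable {F : Finset (Fin n × Fin d)} {m : Fin n →₀ ℕ}

theorem eT_of_admissible {q : ℕ} (h : Admissible I F m) (hq : F.card = q) :
    eT hN I q F m = Finsupp.single (pidx h hq) 1 := by
  rw [eT, e_of_admissible h hq, push_single, map_one]

theorem eT_apply_of_ne {q : ℕ} {F' : Finset (Fin n × Fin d)} {m' : Fin n →₀ ℕ}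
    (h' : Admissible I F' m') (hq' : F'.card = q) (hne : (F, m) ≠ (F', m')) :
    eT hN I q F m (pidx h' hq') = 0 := by
  by_cases h : Admissible I F m ∧ F.card = q
  · rw [eT_of_admissible hN h.1 h.2, Finsupp.single_eq_of_ne]
    intro he
    exact hne (congrArg Subtype.val he).symm
  · rw [eT, e, dif_neg h, map_zero]
    rfl

theorem dT_eT {q : ℕ} (h : Admissible I F m) (hq : F.card = q + 1) :
    dT hN I (q + 1) (eT hN I (q + 1) F m) = ∑ p ∈ F, ((-1 : ℤ) ^ pos F p) •
      ((X (phi hN p) : MvPolynomial (Fin N) k) • eT hN I q (F.erase p) m -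
        (monomial ((Finsupp.single p 1 + bpol d m - bpol d (angle I m p.1)).mapDomain (phi hN))
          (1 : k) : MvPolynomial (Fin N) k) • eT hN I q (F.erase p) (angle I m p.1)) := by
  rw [eT, dT_push, diff_e h hq, map_sum]
  refine Finset.sum_congr rfl fun p _ => ?_
  rw [map_zsmul, map_sub, push_smul, push_smul, toT_eq_rename, rename_X, rename_monomial]
  rfl

theorem dT_zero_eT (h : Admissible I F m) (hq : F.card = 0) :
    dT hN I 0 (eT hN I 0 F m)
      = Finsupp.single (pidxZero I d) (monomial ((bpol d m).mapDomain (phi hN)) 1) := by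
  rw [eT, dT_push, diff_zero_e h hq, push_single, toT_eq_rename, rename_monomial]

end Coordinates

/-! ### Exactness over `T` -/

section Exactness

variable {k : Type u} [Field k] {n d : ℕ} {I : Ideal (MvPolynomial (Fin n) k)}
  {a : ℕ → ℕ} {N : ℕ} (hN : ∀ (i : Fin n) (j : Fin d), (i : ℕ) + a j < N)

/-- The generator `m` belonging to the basis element `e(F, b-pol(m))`. -/
def gen {q : ℕ} (x : PIdx I d (q + 1)) : Fin n →₀ ℕ := x.1.2

/-- The span of the `e(F, b-pol(m))` with `m` of rank less than `r`. -/
def fil (I : Ideal (MvPolynomial (Fin n) k)) (d N r q : ℕ) :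
    Submodule (MvPolynomial (Fin N) k) (PIdx I d (q + 1) →₀ MvPolynomial (Fin N) k) :=
  Finsupp.supported _ _ {x | rank I (gen x) < r}

variable {F : Finset (Fin n × Fin d)} {m : Fin n →₀ ℕ}

theorem eT_mem_fil {q r : ℕ} (h : rank I m < r) : eT hN I q F m ∈ fil I d N r q := by
  by_cases h' : Admissible I F m ∧ F.card = q
  · rw [eT_of_admissible hN h'.1 h'.2]
    exact Finsupp.single_mem_supported _ _ h
  · rw [eT, e, dif_neg h', map_zero]
    exact zero_mem _

/-- The combination of the `e(F, b-pol(m))`, for a fixed `m`, with coefficients `c`. -/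
def comb (I : Ideal (MvPolynomial (Fin n) k)) (q : ℕ) (m : Fin n →₀ ℕ)
    (c : Finset (Fin n × Fin d) → MvPolynomial (Fin N) k) :
    PIdx I d (q + 1) →₀ MvPolynomial (Fin N) k :=
  ∑ S ∈ (validSet d m).powersetCard q, c S • eT hN I q S m

theorem comb_apply_self {q : ℕ} (c : Finset (Fin n × Fin d) → MvPolynomial (Fin N) k)
    (h : Admissible I F m) (hq : F.card = q) : comb hN I q m c (pidx h hq) = c F := by
  rw [comb, Finsupp.finsetSum_apply, Finset.sum_eq_single F]
  · rw [eT_of_admissible hN h hq, Finsupp.smul_apply, Finsupp.single_eq_same, smul_eq_mul, mul_one]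
  · intro S _ hS
    rw [Finsupp.smul_apply, eT_apply_of_ne hN h hq (by simp [hS]), smul_zero]
  · intro hF
    exact absurd (Finset.mem_powersetCard.2 ⟨(admissible_iff_subset.1 h).2, hq⟩) hF

theorem comb_apply_of_ne {q : ℕ} (c : Finset (Fin n × Fin d) → MvPolynomial (Fin N) k)
    {m' : Fin n →₀ ℕ} (h : Admissible I F m') (hq : F.card = q) (hne : m ≠ m') :
    comb hN I q m c (pidx h hq) = 0 := by
  rw [comb, Finsupp.finsetSum_apply]
  refine Finset.sum_eq_zero fun S _ => ?_
  rw [Finsupp.smul_apply, eT_apply_of_ne hN h hq (by simp [hne]), smul_zero]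

theorem sum_powersetCard_succ {ι M : Type*} [DecidableEq ι] [AddCommMonoid M] (V : Finset ι)
    (q : ℕ) (f : Finset ι → ι → M) :
    ∑ S ∈ V.powersetCard (q + 1), ∑ p ∈ S, f S p
      = ∑ S ∈ V.powersetCard q, ∑ p ∈ V \ S, f (insert p S) p := by
  rw [Finset.sum_sigma', Finset.sum_sigma']
  refine Finset.sum_bij' (fun x _ => ⟨x.1.erase x.2, x.2⟩) (fun x _ => ⟨insert x.2 x.1, x.2⟩)
    ?_ ?_ ?_ ?_ ?_
  · rintro ⟨S, p⟩ h
    simp only [Finset.mem_sigma, Finset.mem_powersetCard, Finset.mem_sdiff] at h ⊢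
    refine ⟨⟨(Finset.erase_subset p S).trans h.1.1, ?_⟩, h.1.1 h.2, Finset.notMem_erase p S⟩
    rw [Finset.card_erase_of_mem h.2, h.1.2, Nat.add_sub_cancel]
  · rintro ⟨S, p⟩ h
    simp only [Finset.mem_sigma, Finset.mem_powersetCard, Finset.mem_sdiff] at h ⊢
    refine ⟨⟨Finset.insert_subset h.2.1 h.1.1, ?_⟩, Finset.mem_insert_self p S⟩
    rw [Finset.card_insert_of_notMem h.2.2, h.1.2]
  · rintro ⟨S, p⟩ h
    simp only [Finset.mem_sigma] at h
    simp only [Finset.insert_erase h.2]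
  · rintro ⟨S, p⟩ h
    simp only [Finset.mem_sigma, Finset.mem_sdiff] at h
    simp only [Finset.erase_insert h.2.2]
  · rintro ⟨S, p⟩ h
    simp only [Finset.mem_sigma] at h
    simp only [Finset.insert_erase h.2]

/-- The signs of the differential. -/
def sgn (S : Finset (Fin n × Fin d)) (p : Fin n × Fin d) : ℤ := (-1) ^ pos S p

theorem sgn_mul_self (S : Finset (Fin n × Fin d)) (p : Fin n × Fin d) : sgn S p * sgn S p = 1 := by
  rw [sgn, ← mul_pow]
  simp

/-- The difference consists of the `angle` terms only, and these have smaller rank: the graded piece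
at `m` is a Koszul complex. -/
theorem IsBorelFixed.dT_comb_sub_mem_fil (hB : IsBorelFixed I) (hG : (G I).Finite) (hm : m ∈ G I)
    (q : ℕ) (c : Finset (Fin n × Fin d) → MvPolynomial (Fin N) k) :
    dT hN I (q + 1) (comb hN I (q + 1) m c)
      - comb hN I q m (koszul (phi hN) sgn (validSet d m) c) ∈ fil I d N (rank I m) q := by
  have h1 : comb hN I q m (koszul (phi hN) sgn (validSet d m) c)
      = ∑ S ∈ (validSet d m).powersetCard (q + 1), ∑ p ∈ S,
          (((sgn S p : ℤ) : MvPolynomial (Fin N) k) * (X (phi hN p) * c S))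
            • eT hN I q (S.erase p) m := by
    rw [sum_powersetCard_succ, comb]
    refine Finset.sum_congr rfl fun S _ => ?_
    rw [koszul, Finset.sum_smul]
    refine Finset.sum_congr rfl fun p hp => ?_
    rw [Finset.erase_insert (Finset.mem_sdiff.1 hp).2]
  rw [h1, comb, map_sum, ← Finset.sum_sub_distrib]
  refine sum_mem fun S hS => ?_
  rw [Finset.mem_powersetCard] at hS
  rw [map_smul, dT_eT hN (admissible_iff_subset.2 ⟨hm, hS.1⟩) hS.2, Finset.smul_sum,
    ← Finset.sum_sub_distrib]
  refine sum_mem fun p hp => ?_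
  have hval := mem_validSet.1 (hS.1 hp)
  have hmem : eT hN I q (S.erase p) (angle I m p.1) ∈ fil I d N (rank I m) q :=
    eT_mem_fil hN (rank_lt_rank hG (hB.angle_spec hm hval.1).1 (hB.toLex_lt_angle hm hval.1))
  have h2 : ∀ z z' : PIdx I d (q + 1) →₀ MvPolynomial (Fin N) k,
      c S • ((-1 : ℤ) ^ pos S p) • ((X (phi hN p) : MvPolynomial (Fin N) k) • z - z')
        - (((sgn S p : ℤ) : MvPolynomial (Fin N) k) * (X (phi hN p) * c S)) • z
      = -(c S * ((sgn S p : ℤ) : MvPolynomial (Fin N) k)) • z' := by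
    intro z z'
    rw [← Int.cast_smul_eq_zsmul (MvPolynomial (Fin N) k), sgn]
    module
  rw [h2]
  exact Submodule.smul_mem _ _ (Submodule.smul_mem _ _ hmem)

theorem IsBorelFixed.dT_mem_fil (hB : IsBorelFixed I) (hG : (G I).Finite) {r q : ℕ}
    {z : PIdx I d (q + 2) →₀ MvPolynomial (Fin N) k} (hz : z ∈ fil I d N r (q + 1)) :
    dT hN I (q + 1) z ∈ fil I d N r q := by
  rw [dT, Finsupp.linearCombination_apply]
  refine sum_mem fun x hx => Submodule.smul_mem _ _ ?_
  have hr : rank I (gen x) < r := (Finsupp.mem_supported _ _).1 hz hx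
  obtain ⟨F, m, h, hq, rfl⟩ := exists_eq_pidx x
  change rank I m < r at hr
  have h1 : push hN (q + 1) (dBasis I d (q + 1) (pidx h hq))
      = dT hN I (q + 1) (eT hN I (q + 1) F m) := by
    rw [eT_of_admissible hN h hq, dT, Finsupp.linearCombination_single, one_smul]
  rw [h1, dT_eT hN h hq]
  refine sum_mem fun p hp => zsmul_mem (sub_mem (Submodule.smul_mem _ _ (eT_mem_fil hN hr))
    (Submodule.smul_mem _ _ (eT_mem_fil hN (lt_trans ?_ hr)))) _
  have hval := (admissible_iff.1 h).2 p hp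
  exact rank_lt_rank hG (hB.angle_spec h.1 hval.1).1 (hB.toLex_lt_angle h.1 hval.1)

theorem dT_zero_mem_span {r : ℕ}
    {z : PIdx I d 1 →₀ MvPolynomial (Fin N) k} (hz : z ∈ fil I d N r 0) :
    dT hN I 0 z (pidxZero I d) ∈
      Ideal.span ((fun u => monomial ((bpol d u).mapDomain (phi hN)) (1 : k)) ''
        {u | u ∈ G I ∧ rank I u < r}) := by
  rw [dT, Finsupp.linearCombination_apply, Finsupp.sum, Finsupp.finsetSum_apply]
  refine sum_mem fun x hx => ?_
  have hr : rank I (gen x) < r := (Finsupp.mem_supported _ _).1 hz hx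
  obtain ⟨F, m, h, hq, rfl⟩ := exists_eq_pidx x
  change rank I m < r at hr
  have h1 : push hN 0 (dBasis I d 0 (pidx h hq)) = dT hN I 0 (eT hN I 0 F m) := by
    rw [eT_of_admissible hN h hq, dT, Finsupp.linearCombination_single, one_smul]
  rw [h1, dT_zero_eT hN h hq, Finsupp.smul_apply, Finsupp.single_eq_same]
  exact Ideal.mul_mem_left _ _ (Ideal.subset_span ⟨m, ⟨h.1, hr⟩, rfl⟩)

theorem exists_sub_comb_mem_fil (hG : (G I).Finite) (hm : m ∈ G I) {q : ℕ}
    {z : PIdx I d (q + 1) →₀ MvPolynomial (Fin N) k} (hz : z ∈ fil I d N (rank I m + 1) q) :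
    ∃ c : Finset (Fin n × Fin d) → MvPolynomial (Fin N) k, (∀ S, S.card ≠ q → c S = 0) ∧
      z - comb hN I q m c ∈ fil I d N (rank I m) q := by
  classical
  -- The default value zero in other cardinalities matters: for `q > 0` it supplies the vanishing at
  -- `∅` needed by `exists_eq_koszul`.
  refine ⟨fun S => if h : Admissible I S m ∧ S.card = q then z (pidx h.1 h.2) else 0,
    fun S hS => dif_neg fun h => hS h.2, ?_⟩
  rw [fil, Finsupp.mem_supported']
  intro x hx
  obtain ⟨F, m', h, hq, rfl⟩ := exists_eq_pidx x
  change ¬ rank I m' < rank I m at hx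
  rw [Finsupp.sub_apply]
  by_cases hmm : m = m'
  · subst hmm
    rw [comb_apply_self, dif_pos ⟨h, hq⟩, sub_self]
  · rw [comb_apply_of_ne hN _ h hq hmm, sub_zero]
    refine (Finsupp.mem_supported' _ _).1 hz _ ?_
    change ¬ rank I m' < rank I m + 1
    have : rank I m ≠ rank I m' := fun he => hmm (eq_of_rank_eq hG hm h.1 he)
    omega

theorem IsBorelFixed.exists_dT_eq_of_mem_fil (hB : IsBorelFixed I) (ha : Monotone a)
    (hd : ∀ m ∈ G I, m.degree ≤ d) (r q : ℕ)
    (z : PIdx I d (q + 1) →₀ MvPolynomial (Fin N) k) (hz : z ∈ fil I d N r q)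
    (h0 : dT hN I q z = 0) : ∃ w, dT hN I (q + 1) w = z := by
  have hG := finite_G hd
  induction r generalizing z with
  | zero =>
    refine ⟨0, ?_⟩
    rw [map_zero]
    ext1 x
    exact ((Finsupp.mem_supported' _ _).1 hz x (by simp)).symm
  | succ r ih =>
    by_cases hex : ∃ m ∈ G I, rank I m = r
    swap
    · refine ih z ?_ h0
      rw [fil, Finsupp.mem_supported]
      intro x hx
      have h1 : rank I (gen x) < r + 1 := (Finsupp.mem_supported _ _).1 hz hx
      have h2 : rank I (gen x) ≠ r := fun h => hex ⟨gen x, x.2.1.1, h⟩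
      exact lt_of_le_of_ne (Nat.lt_succ_iff.1 h1) h2
    obtain ⟨m, hm, rfl⟩ := hex
    obtain ⟨c, hc, hcz⟩ := exists_sub_comb_mem_fil hN hG hm hz
    -- The leading part `c` of the cycle is a Koszul boundary: by linear quotients if `q = 0`, by
    -- Koszul acyclicity otherwise.
    have hw : ∃ w : Finset (Fin n × Fin d) → MvPolynomial (Fin N) k,
        ∀ S ⊆ validSet d m, S.card = q → c S = koszul (phi hN) sgn (validSet d m) w S := by
      cases q with
      | zero =>
        have h1 := dT_zero_mem_span hN hcz
        have hadm : Admissible I (∅ : Finset (Fin n × Fin d)) m :=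
          admissible_iff_subset.2 ⟨hm, Finset.empty_subset _⟩
        have h2 : dT hN I 0 (comb hN I 0 m c) (pidxZero I d)
            = c ∅ * monomial ((bpol d m).mapDomain (phi hN)) 1 := by
          rw [comb, Finset.powersetCard_zero, Finset.sum_singleton, map_smul,
            dT_zero_eT hN hadm rfl, Finsupp.smul_apply, Finsupp.single_eq_same, smul_eq_mul]
        rw [map_sub, h0, zero_sub, Finsupp.neg_apply, h2, neg_mem_iff] at h1
        have h3 := mem_span_X_of_mul_mem ha hN hm (hd m hm)
          (fun u hu => ⟨hu.1, toLex_lt_of_rank_lt hG hm hu.2⟩) h1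
        obtain ⟨b, hb⟩ := (Submodule.mem_span_image_finset_iff_exists_fun _).1 h3
        -- The coefficients `b` expressing `c ∅` through the variables are placed on singletons,
        -- with the sign that cancels the one in `koszul`.
        refine ⟨fun S => ∑ p : validSet d m, if S = {p.1} then
          ((sgn S p.1 : ℤ) : MvPolynomial (Fin N) k) * b p else 0, fun S _ hS => ?_⟩
        rw [Finset.card_eq_zero] at hS
        subst hS
        rw [← hb, koszul, Finset.sdiff_empty, ← Finset.sum_attach (validSet d m)]
        simp only [Finset.univ_eq_attach]
        refine Finset.sum_congr rfl fun p _ => ?_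
        rw [Finset.sum_eq_single p]
        · have h4 := congrArg (fun z : ℤ => (z : MvPolynomial (Fin N) k)) (sgn_mul_self {p.1} p.1)
          push_cast at h4
          rw [LawfulSingleton.insert_empty_eq, if_pos rfl, smul_eq_mul]
          linear_combination (-b p * X (phi hN p)) * h4
        · intro p' _ hp'
          rw [if_neg]
          intro h
          rw [LawfulSingleton.insert_empty_eq, Finset.singleton_inj] at h
          exact hp' (Subtype.ext h.symm)
        · simp
      | succ q =>
        obtain ⟨w, hw⟩ := exists_eq_koszul (y := phi hN) (ε := sgn) (V := validSet d m)
          (phi_injOn ha hN m) sgn_mul_self (fun S hS p hp s hs hps =>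
            sign_erase_comm hp hs fun h => hps ((admissible_iff_subset.2 ⟨hm, hS⟩ :
              Admissible I S m).fst_injOn hp hs h)) c (hc ∅ (by simp)) (fun S hS => by
            by_cases hSq : S.card = q
            · have h1 := hB.dT_mem_fil hN hG hcz
              have h2 := hB.dT_comb_sub_mem_fil hN hG hm q c
              rw [map_sub, h0, zero_sub] at h1
              have h3 := neg_mem (add_mem h1 h2)
              rw [neg_add_eq_sub, sub_sub_cancel_left, neg_neg] at h3
              have hadm : Admissible I S m := admissible_iff_subset.2 ⟨hm, hS⟩
              have h4 := (Finsupp.mem_supported' _ _).1 h3 (pidx hadm hSq)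
                (by change ¬ rank I m < rank I m; exact lt_irrefl _)
              rwa [comb_apply_self] at h4
            · refine Finset.sum_eq_zero fun p hp => ?_
              rw [hc, mul_zero, mul_zero]
              rw [Finset.card_insert_of_notMem (Finset.mem_sdiff.1 hp).2]
              omega)
        exact ⟨w, fun S hS _ => hw S hS⟩
    obtain ⟨w, hw⟩ := hw
    have hcw : comb hN I q m c = comb hN I q m (koszul (phi hN) sgn (validSet d m) w) := by
      rw [comb, comb]
      refine Finset.sum_congr rfl fun S hS => ?_
      rw [Finset.mem_powersetCard] at hS
      rw [hw S hS.1 hS.2]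
    -- Subtracting the boundary of the lifted `w` removes the leading part, so the remaining cycle
    -- falls under the induction hypothesis.
    have hmem : z - dT hN I (q + 1) (comb hN I (q + 1) m w) ∈ fil I d N (rank I m) q := by
      have h1 := sub_mem hcz (hB.dT_comb_sub_mem_fil hN hG hm q w)
      rw [hcw] at h1
      convert h1 using 1
      abel
    obtain ⟨w', hw'⟩ := ih _ hmem (by rw [map_sub, h0, hB.dT_dT, sub_zero])
    exact ⟨w' + comb hN I (q + 1) m w, by rw [map_add, hw', sub_add_cancel]⟩

theorem IsBorelFixed.exact_dT (hB : IsBorelFixed I) (ha : Monotone a)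
    (hd : ∀ m ∈ G I, m.degree ≤ d) (q : ℕ) :
    Function.Exact (dT hN I (q + 1)) (dT hN I q) := by
  intro z
  constructor
  · intro h0
    refine hB.exists_dT_eq_of_mem_fil hN ha hd (G I).ncard q z ?_ h0
    rw [fil, Finsupp.mem_supported]
    intro x _
    exact rank_lt_ncard (finite_G hd) x.2.1.1
  · rintro ⟨w, rfl⟩
    exact hB.dT_dT hN q w

end Exactness

/-! ### The map `S̃ / (Θ_a) → T` -/

section ThetaMap

variable {k : Type u} [Field k] {n d : ℕ} {a : ℕ → ℕ} {N : ℕ}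
  (hN : ∀ (i : Fin n) (j : Fin d), (i : ℕ) + a j < N)
  {ι : Type v} (Θ : Module.Basis ι k (L k n d a))

/-- Shows that the ideal does not depend on the chosen basis. -/
theorem mem_thetaIdeal_of_mem_L {f : MvPolynomial (Fin n × Fin d) k} (hf : f ∈ L k n d a) :
    f ∈ thetaIdeal Θ := by
  have h : (⊤ : Submodule k (L k n d a)) ≤
      ((thetaIdeal Θ).restrictScalars k).comap (L k n d a).subtype := by
    rw [← Θ.span_eq, Submodule.span_le]
    rintro _ ⟨t, rfl⟩
    exact Ideal.subset_span ⟨t, rfl⟩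
  exact h (x := ⟨f, hf⟩) trivial

theorem thetaMap_mk (f : MvPolynomial (Fin n × Fin d) k) :
    thetaMap hN Θ (Ideal.Quotient.mk _ f) = toT k hN f := rfl

theorem thetaMap_injective : Function.Injective (thetaMap hN Θ) := by
  rw [injective_iff_map_eq_zero]
  intro x hx
  obtain ⟨f, rfl⟩ := Ideal.Quotient.mk_surjective x
  rw [thetaMap_mk, toT_eq_rename] at hx
  rcases isEmpty_or_nonempty (Fin n × Fin d) with hE | hE
  · rw [rename_injective (phi hN) (Function.injective_of_subsingleton _) (hx.trans (map_zero _).symm),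
      map_zero]
  -- Renaming along `phi` and back along a section moves each variable within its fibre, hence is
  -- the identity modulo `Θ`; so a polynomial killed by `phi` is zero there.
  have h : (Ideal.Quotient.mkₐ k (thetaIdeal Θ)).comp
      ((rename (Function.invFun (phi hN))).comp (rename (phi hN)))
      = Ideal.Quotient.mkₐ k (thetaIdeal Θ) := by
    ext p
    simp only [AlgHom.comp_apply, rename_X, Ideal.Quotient.mkₐ_eq_mk]
    rw [Ideal.Quotient.eq]
    refine mem_thetaIdeal_of_mem_L Θ (Submodule.subset_span ⟨_, _, ?_, rfl⟩)
    have := Function.invFun_eq (f := phi hN) ⟨p, rfl⟩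
    exact congrArg Fin.val this
  have h1 := DFunLike.congr_fun h f
  simp only [AlgHom.comp_apply, hx, map_zero] at h1
  exact h1.symm

theorem thetaMap_surjective (h : ∀ l : Fin N, ∃ (i : Fin n) (j : Fin d), (l : ℕ) = i + a j) :
    Function.Surjective (thetaMap hN Θ) := by
  intro f
  have hs : Function.Surjective (phi hN) := fun l => by
    obtain ⟨i, j, hij⟩ := h l
    exact ⟨(i, j), Fin.ext hij.symm⟩
  obtain ⟨f', hf'⟩ := rename_surjective (R := k) (phi hN) hs f
  exact ⟨Ideal.Quotient.mk _ f', by rw [thetaMap_mk, toT_eq_rename, hf']⟩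

end ThetaMap

/-! ### Bases after extension of scalars -/

section ExtScal

variable {R : Type u} {R' : Type v} [CommRing R] [CommRing R'] (f : R →+* R')
  {M M' : Type w} [AddCommGroup M'] [Module R M'] [AddCommGroup M] [Module R M]

/-- The canonical map `M → R' ⊗_R M`. -/
def ExtScal.of : M →+ ExtScal f M :=
  letI := f.toAlgebra
  ((TensorProduct.mk R R' M 1).toAddMonoidHom : M →+ R' ⊗[R] M)

theorem ExtScal.of_smul (c : R) (x : M) : ExtScal.of f (c • x) = f c • ExtScal.of f x := by
  let := f.toAlgebra
  change (1 : R') ⊗ₜ[R] (c • x) = f c • ((1 : R') ⊗ₜ[R] x)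
  rw [TensorProduct.tmul_smul, TensorProduct.smul_tmul', TensorProduct.smul_tmul',
    Algebra.smul_def, smul_eq_mul]
  rfl

theorem ExtScal.map_of (l : M →ₗ[R] M') (x : M) :
    ExtScal.map f l (ExtScal.of f x) = ExtScal.of f (l x) := by
  let := f.toAlgebra
  exact LinearMap.baseChange_tmul (A := R') (R := R) l 1 x

/-- The basis of `R' ⊗_R M` given by a basis of `M`. -/
def ExtScal.basis {κ : Type*} (b : Module.Basis κ R M) : Module.Basis κ R' (ExtScal f M) :=
  letI := f.toAlgebra
  (b.baseChange R' : Module.Basis κ R' (R' ⊗[R] M))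

theorem ExtScal.basis_apply {κ : Type*} (b : Module.Basis κ R M) (i : κ) :
    ExtScal.basis f b i = ExtScal.of f (b i) := by
  let := f.toAlgebra
  exact Module.Basis.baseChange_apply R' b i

end ExtScal

/-! ### Identification of the base-changed complex with the coordinate complex `dT` -/

section PTBasis

variable {k : Type u} [Field k] {n d : ℕ} (I : Ideal (MvPolynomial (Fin n) k))
  {a : ℕ → ℕ} {N : ℕ} (hN : ∀ (i : Fin n) (j : Fin d), (i : ℕ) + a j < N)
  {ι : Type v} (Θ : Module.Basis ι k (L k n d a))

/-- The basis of the complex over `T` consisting of the images of the `e(F, b-pol(m))`. -/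
def basisT (q : ℕ) : Module.Basis (PIdx I d q) (MvPolynomial (Fin N) k) (PT I hN Θ q) :=
  ExtScal.basis (thetaMap hN Θ)
    ((Finsupp.basisSingleOne : Module.Basis (PIdx I d q) (MvPolynomial (Fin n × Fin d) k)
      (P I d q)).baseChange (MvPolynomial (Fin n × Fin d) k ⧸ thetaIdeal Θ))

/-- The canonical map from the complex over `S̃` to the complex over `T`. -/
def ofP (q : ℕ) : P I d q →+ PT I hN Θ q :=
  (ExtScal.of (thetaMap hN Θ)).comp
    (TensorProduct.mk (MvPolynomial (Fin n × Fin d) k)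
      (MvPolynomial (Fin n × Fin d) k ⧸ thetaIdeal Θ) (P I d q) 1).toAddMonoidHom

theorem ofP_smul (q : ℕ) (c : MvPolynomial (Fin n × Fin d) k) (z : P I d q) :
    ofP I hN Θ q (c • z) = toT k hN c • ofP I hN Θ q z := by
  have h : (1 : MvPolynomial (Fin n × Fin d) k ⧸ thetaIdeal Θ)
      ⊗ₜ[MvPolynomial (Fin n × Fin d) k] (c • z)
      = Ideal.Quotient.mk (thetaIdeal Θ) c • ((1 : MvPolynomial (Fin n × Fin d) k ⧸ thetaIdeal Θ)
        ⊗ₜ[MvPolynomial (Fin n × Fin d) k] z) := by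
    rw [TensorProduct.tmul_smul, TensorProduct.smul_tmul', TensorProduct.smul_tmul',
      smul_eq_mul, mul_one]
    congr 1
    exact (Algebra.algebraMap_eq_smul_one c).symm
  change ExtScal.of (thetaMap hN Θ) ((1 : MvPolynomial (Fin n × Fin d) k ⧸ thetaIdeal Θ)
    ⊗ₜ[MvPolynomial (Fin n × Fin d) k] (c • z)) = _
  rw [h, ExtScal.of_smul, thetaMap_mk]
  rfl

theorem basisT_apply (q : ℕ) (x : PIdx I d q) :
    basisT I hN Θ q x = ofP I hN Θ q (Finsupp.single x 1) := by
  rw [basisT, ExtScal.basis_apply, Module.Basis.baseChange_apply, Finsupp.coe_basisSingleOne]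
  rfl

theorem basisT_repr_symm_push (q : ℕ) (z : P I d q) :
    (basisT I hN Θ q).repr.symm (push hN q z) = ofP I hN Θ q z := by
  induction z using Finsupp.induction_linear with
  | zero => simp only [map_zero]
  | add z z' h h' => simp only [map_add, h, h']
  | single x c =>
    rw [push_single, Module.Basis.repr_symm_single, basisT_apply, ← ofP_smul, Finsupp.smul_single,
      smul_eq_mul, mul_one]

theorem diffT_repr_symm (q : ℕ) (z : PIdx I d (q + 1) →₀ MvPolynomial (Fin N) k) :
    diffT I hN Θ q ((basisT I hN Θ (q + 1)).repr.symm z)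
      = (basisT I hN Θ q).repr.symm (dT hN I q z) := by
  induction z using Finsupp.induction_linear with
  | zero => simp only [map_zero]
  | add z z' h h' => simp only [map_add, h, h']
  | single x c =>
    rw [Module.Basis.repr_symm_single, map_smul, basisT_apply, dT,
      Finsupp.linearCombination_single, map_smul, basisT_repr_symm_push, ← diff_single]
    exact congrArg (c • ·) (ExtScal.map_of _ _ _)

theorem repr_diffT (q : ℕ) (z : PT I hN Θ (q + 1)) :
    (basisT I hN Θ q).repr (diffT I hN Θ q z)
      = dT hN I q ((basisT I hN Θ (q + 1)).repr z) := by
  rw [← LinearEquiv.eq_symm_apply, ← diffT_repr_symm, LinearEquiv.symm_apply_apply]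

end PTBasis

/-! ### Minimality and multidegrees -/

section Minimality

variable {k : Type u} [Field k] {n d : ℕ} {I : Ideal (MvPolynomial (Fin n) k)}
  {a : ℕ → ℕ} {N : ℕ} (hN : ∀ (i : Fin n) (j : Fin d), (i : ℕ) + a j < N)

theorem finite_PIdx (hd : ∀ m ∈ G I, m.degree ≤ d) (q : ℕ) : Finite (PIdx I d q) := by
  cases q with
  | zero => exact inferInstanceAs (Finite Unit)
  | succ q =>
    have : Finite (G I) := finite_G hd
    refine Finite.of_injective (β := Finset (Fin n × Fin d) × G I)
      (fun x : A I d q => (x.1.1, ⟨x.1.2, x.2.1.1⟩)) ?_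
    intro x y h
    simp only [Prod.mk.injEq, Subtype.mk.injEq] at h
    exact Subtype.ext (Prod.ext h.1 h.2)

/-- The multidegrees of the basis elements over `T`. -/
def degT : (q : ℕ) → PIdx I d q → (Fin N →₀ ℕ)
  | 0, _ => 0
  | _ + 1, x => (edeg d x.1.1 x.1.2).mapDomain (phi hN)

/-- The elements that are homogeneous of degree `D`. -/
def homogeneous (I : Ideal (MvPolynomial (Fin n) k)) (q : ℕ) (D : Fin N →₀ ℕ) :
    AddSubgroup (PIdx I d q →₀ MvPolynomial (Fin N) k) where
  carrier := {z | ∀ x, ∀ s ∈ (z x).support, s + degT hN q x = D}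
  zero_mem' := by simp
  add_mem' := by
    classical
    intro z z' h h' x s hs
    rcases Finset.mem_union.1 (MvPolynomial.support_add hs) with h1 | h1
    · exact h x s h1
    · exact h' x s h1
  neg_mem' := by
    intro z h x s hs
    rw [Finsupp.neg_apply, MvPolynomial.support_neg] at hs
    exact h x s hs

theorem single_monomial_mem_homogeneous {q : ℕ} {D s : Fin N →₀ ℕ} {x : PIdx I d q} {c : k}
    (h : s + degT hN q x = D) :
    Finsupp.single x (monomial s c) ∈ homogeneous hN I q D := by
  classical
  intro y t ht
  by_cases hxy : x = y
  · subst hxy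
    rw [Finsupp.single_eq_same] at ht
    rwa [Finset.mem_singleton.1 (support_monomial_subset ht)]
  · rw [Finsupp.single_eq_of_ne (Ne.symm hxy)] at ht
    simp at ht

theorem monomial_smul_eT_mem_homogeneous {q : ℕ} {D s : Fin N →₀ ℕ}
    {F : Finset (Fin n × Fin d)} {m : Fin n →₀ ℕ}
    (h : s + (edeg d F m).mapDomain (phi hN) = D) :
    (monomial s (1 : k) : MvPolynomial (Fin N) k) • eT hN I q F m
      ∈ homogeneous hN I (q + 1) D := by
  by_cases h' : Admissible I F m ∧ F.card = q
  · rw [eT_of_admissible hN h'.1 h'.2, Finsupp.smul_single, smul_eq_mul, mul_one]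
    exact single_monomial_mem_homogeneous hN h
  · rw [eT, e, dif_neg h', map_zero, smul_zero]
    exact zero_mem _

theorem IsBorelFixed.dT_single_mem_homogeneous (hB : IsBorelFixed I) (q : ℕ)
    (x : PIdx I d (q + 1)) :
    dT hN I q (Finsupp.single x 1) ∈ homogeneous hN I q (degT hN (q + 1) x) := by
  obtain ⟨F, m, h, hq, rfl⟩ := exists_eq_pidx x
  rw [← eT_of_admissible hN]
  cases q with
  | zero =>
    rw [dT_zero_eT hN h hq]
    refine single_monomial_mem_homogeneous hN ?_
    change _ + 0 = (edeg d F m).mapDomain (phi hN)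
    rw [edeg, Finset.card_eq_zero.1 hq, Finset.sum_empty, add_zero, add_zero]
  | succ q =>
    rw [dT_eT hN h hq]
    refine sum_mem fun p hp => zsmul_mem (sub_mem ?_ ?_) _
    · refine monomial_smul_eT_mem_homogeneous hN ?_
      change _ = (edeg d F m).mapDomain (phi hN)
      rw [← edeg_erase_add m hp, Finsupp.mapDomain_add, Finsupp.mapDomain_single, add_comm]
    · refine monomial_smul_eT_mem_homogeneous hN ?_
      change _ = (edeg d F m).mapDomain (phi hN)
      rw [← hB.edeg_erase_angle_add h hp, Finsupp.mapDomain_add, add_comm]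

theorem mapDomain_ne_zero {σ τ : Type*} [Fintype σ] (f : σ → τ) {x : σ →₀ ℕ} (hx : x ≠ 0) :
    x.mapDomain f ≠ 0 := by
  classical
  intro h
  refine hx (Finsupp.ext fun s => ?_)
  have h1 := DFunLike.congr_fun h (f s)
  rw [mapDomain_apply_eq_sum, Finsupp.coe_zero, Pi.zero_apply, Finset.sum_eq_zero_iff] at h1
  exact h1 s (by simp)

theorem monomial_mem_span_range_X {σ : Type*} {s : σ →₀ ℕ} (hs : s ≠ 0) :
    (monomial s (1 : k) : MvPolynomial σ k) ∈
      Ideal.span (Set.range (X : σ → MvPolynomial σ k)) := by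
  classical
  rw [← Set.image_univ, mem_ideal_span_X_image]
  intro t ht
  rw [Finset.mem_singleton.1 (support_monomial_subset ht)]
  obtain ⟨i, hi⟩ := Finsupp.ne_iff.1 hs
  exact ⟨i, trivial, hi⟩

theorem IsBorelFixed.dT_mem_smul_top (hB : IsBorelFixed I) (hI : I ≠ ⊤)
    (hd : ∀ m ∈ G I, m.degree ≤ d) (q : ℕ)
    (z : PIdx I d (q + 1) →₀ MvPolynomial (Fin N) k) :
    dT hN I q z ∈ (Ideal.span (Set.range (X : Fin N → MvPolynomial (Fin N) k)) :
      Ideal (MvPolynomial (Fin N) k)) •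
        (⊤ : Submodule (MvPolynomial (Fin N) k) (PIdx I d q →₀ MvPolynomial (Fin N) k)) := by
  induction z using Finsupp.induction_linear with
  | zero => rw [map_zero]; exact zero_mem _
  | add z z' h h' => rw [map_add]; exact add_mem h h'
  | single x c =>
    have h1 : Finsupp.single x c = c • Finsupp.single x (1 : MvPolynomial (Fin N) k) := by
      rw [Finsupp.smul_single, smul_eq_mul, mul_one]
    rw [h1, map_smul]
    refine Submodule.smul_mem _ _ ?_
    obtain ⟨F, m, h, hq, rfl⟩ := exists_eq_pidx x
    rw [← eT_of_admissible hN]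
    cases q with
    | zero =>
      have hm0 : m ≠ 0 := by
        rintro rfl
        refine hI ((Ideal.eq_top_iff_one I).2 ?_)
        exact h.1.1
      rw [dT_zero_eT hN h hq]
      have h2 : Finsupp.single (pidxZero I d)
          (monomial ((bpol d m).mapDomain (phi hN)) (1 : k))
          = monomial ((bpol d m).mapDomain (phi hN)) (1 : k) • Finsupp.single (pidxZero I d) 1 := by
        rw [Finsupp.smul_single, smul_eq_mul, mul_one]
      rw [h2]
      exact Submodule.smul_mem_smul (monomial_mem_span_range_X
        (mapDomain_ne_zero _ (bpol_ne_zero (hd m h.1) hm0))) trivial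
    | succ q =>
      rw [dT_eT hN h hq]
      refine sum_mem fun p hp => zsmul_mem (sub_mem ?_ ?_) _
      · exact Submodule.smul_mem_smul (Ideal.subset_span ⟨_, rfl⟩) trivial
      · have hv := (admissible_iff.1 h).2 p hp
        exact Submodule.smul_mem_smul (monomial_mem_span_range_X
          (mapDomain_ne_zero _ (hB.single_add_bpol_sub_ne_zero h.1 hv.1 hv.2))) trivial

end Minimality

/-! ### The main result -/

section Main

variable {k : Type u} [Field k] {n d : ℕ} {I : Ideal (MvPolynomial (Fin n) k)}
  {a : ℕ → ℕ} {N : ℕ} (hN : ∀ (i : Fin n) (j : Fin d), (i : ℕ) + a j < N)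

theorem gammaIdeal_eq (hd : ∀ m ∈ G I, m.degree ≤ d) :
    gammaIdeal I a N =
      Ideal.span ((fun m => monomial ((bpol d m).mapDomain (phi hN)) (1 : k)) '' G I) := by
  rw [gammaIdeal]
  congr 1
  refine Set.image_congr fun m hm => ?_
  rw [gammaMon_eq_mapDomain hN (hd m hm)]
  rfl

/-- Identifies the zeroth homology: the lowest differential sends the basis elements to the
generators of `gammaIdeal I a N`. -/
theorem mem_range_dT_zero_iff (hd : ∀ m ∈ G I, m.degree ≤ d)
    (z : PIdx I d 0 →₀ MvPolynomial (Fin N) k) :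
    z (pidxZero I d) ∈ gammaIdeal I a N ↔ z ∈ Set.range (dT hN I 0) := by
  rw [gammaIdeal_eq hN hd]
  constructor
  · intro hz
    have hle : Ideal.span ((fun m => monomial ((bpol d m).mapDomain (phi hN)) (1 : k)) '' G I)
        ≤ (LinearMap.range (dT hN I 0)).map (Finsupp.lapply (pidxZero I d)) := by
      refine Ideal.span_le.2 ?_
      rintro _ ⟨m, hm, rfl⟩
      have hadm : Admissible I (∅ : Finset (Fin n × Fin d)) m :=
        admissible_iff_subset.2 ⟨hm, Finset.empty_subset _⟩
      refine ⟨_, ⟨eT hN I 0 ∅ m, rfl⟩, ?_⟩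
      rw [dT_zero_eT hN hadm rfl, Finsupp.lapply_apply, Finsupp.single_eq_same]
    obtain ⟨_, ⟨w, rfl⟩, hw⟩ := hle hz
    exact ⟨w, Finsupp.ext fun _ => hw⟩
  · rintro ⟨w, rfl⟩
    have h := dT_zero_mem_span hN (r := (G I).ncard) (z := w) (by
      rw [fil, Finsupp.mem_supported]
      intro x _
      exact rank_lt_ncard (finite_G hd) x.2.1.1)
    exact Ideal.span_mono (Set.image_mono fun u hu => hu.1) h

theorem IsBorelFixed.isMinimalFreeResolution (hB : IsBorelFixed I) (hI : I ≠ ⊤)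
    (hd : ∀ m ∈ G I, m.degree ≤ d) (ha : Monotone a)
    {ι : Type v} (Θ : Module.Basis ι k (L k n d a)) :
    IsMinimalFreeResolution (PT I hN Θ) (diffT I hN Θ) (gammaIdeal I a N) := by
  have hfin := finite_PIdx hd
  set B := basisT I hN Θ with hBdef
  refine ⟨(gammaIdeal I a N).mkQ ∘ₗ Finsupp.lapply (pidxZero I d) ∘ₗ (B 0).repr.toLinearMap,
    fun q => Nat.card (PIdx I d q), fun q => (B q).reindex (Finite.equivFin (PIdx I d q)),
    fun q t => degT hN q ((Finite.equivFin (PIdx I d q)).symm t), ?_, ?_, ?_, ?_, ?_, ?_⟩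
  · intro y
    obtain ⟨f, rfl⟩ := Submodule.mkQ_surjective _ y
    refine ⟨(B 0).repr.symm (Finsupp.single (pidxZero I d) f), ?_⟩
    simp only [LinearMap.comp_apply, LinearEquiv.coe_coe, LinearEquiv.apply_symm_apply,
      Finsupp.lapply_apply, Finsupp.single_eq_same]
  · intro z
    have h1 : ((gammaIdeal I a N).mkQ ∘ₗ Finsupp.lapply (pidxZero I d) ∘ₗ
        (B 0).repr.toLinearMap) z = 0 ↔ (B 0).repr z (pidxZero I d) ∈ gammaIdeal I a N :=
      Submodule.Quotient.mk_eq_zero _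
    rw [h1, mem_range_dT_zero_iff hN hd]
    constructor
    · rintro ⟨w, hw⟩
      exact ⟨(B 1).repr.symm w, by
        rw [diffT_repr_symm, hw, LinearEquiv.symm_apply_apply]⟩
    · rintro ⟨w, rfl⟩
      exact ⟨_, (repr_diffT I hN Θ 0 w).symm⟩
  · intro q
    refine (Function.Exact.iff_of_ladder_linearEquiv (e₁ := (B (q + 2)).repr.symm)
      (e₂ := (B (q + 1)).repr.symm) (e₃ := (B q).repr.symm) ?_ ?_).2 (hB.exact_dT hN ha hd q)
    · exact LinearMap.ext fun z => diffT_repr_symm I hN Θ (q + 1) z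
    · exact LinearMap.ext fun z => diffT_repr_symm I hN Θ q z
  · intro t
    refine ⟨1, ?_⟩
    have h1 : (Finite.equivFin (PIdx I d 0)).symm t = pidxZero I d := rfl
    rw [Module.Basis.reindex_apply, h1]
    simp only [LinearMap.comp_apply, LinearEquiv.coe_coe, Module.Basis.repr_self,
      Finsupp.lapply_apply, Finsupp.single_eq_same]
    rfl
  · intro q t t' s hs
    rw [Module.Basis.reindex_apply, Module.Basis.repr_reindex_apply, repr_diffT,
      Module.Basis.repr_self] at hs
    exact hB.dT_single_mem_homogeneous hN q _ _ s hs
  · rintro q _ ⟨z, rfl⟩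
    have h1 := hB.dT_mem_smul_top hN hI hd q ((B (q + 1)).repr z)
    rw [← repr_diffT] at h1
    have h2 := Submodule.mem_map_of_mem (f := (B q).repr.symm.toLinearMap) h1
    rw [Submodule.map_smul''] at h2
    have h3 : (B q).repr.symm.toLinearMap ((basisT I hN Θ q).repr (diffT I hN Θ q z))
        = diffT I hN Θ q z := LinearEquiv.symm_apply_apply _ _
    rw [h3] at h2
    exact Submodule.smul_mono le_rfl le_top h2

end Main

end BoxPol

end

theorem mainTheorem4 {k : Type*} [Field k] {n d : ℕ}
    (I : Ideal (MvPolynomial (Fin n) k))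
    (hI : BoxPol.IsMonomialIdeal I) (hI_ne : I ≠ ⊤) (hB : BoxPol.IsBorelFixed I)
    (hd : ∀ m ∈ BoxPol.G I, m.degree ≤ d) :
    (∀ (a : ℕ → ℕ), Monotone a → a 0 = 0 →
      ∀ (N : ℕ) (hN : ∀ (i : Fin n) (j : Fin d), (i : ℕ) + a j < N)
        {ι : Type*} (Θ : Module.Basis ι k (BoxPol.L k n d a)),
        Function.Injective (BoxPol.thetaMap hN Θ) ∧
        ((∀ l : Fin N, ∃ (i : Fin n) (j : Fin d), (l : ℕ) = i + a j) →
          Function.Bijective (BoxPol.thetaMap hN Θ)) ∧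
        BoxPol.IsMinimalFreeResolution (BoxPol.PT I hN Θ) (BoxPol.diffT I hN Θ)
          (BoxPol.gammaIdeal I a N)) ∧
    (∀ (N : ℕ) (hN : ∀ (i : Fin n) (j : Fin d), (i : ℕ) + (j : ℕ) < N)
        {ι : Type*} (Θ : Module.Basis ι k (BoxPol.L k n d (fun r => r))),
        BoxPol.IsMinimalFreeResolution (BoxPol.PT (a := fun r => r) I hN Θ) (BoxPol.diffT (a := fun r => r) I hN Θ)
          (BoxPol.sqIdeal I N)) := by
  refine ⟨fun a ha _ N hN ι Θ => ⟨BoxPol.thetaMap_injective hN Θ, fun h =>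
    ⟨BoxPol.thetaMap_injective hN Θ, BoxPol.thetaMap_surjective hN Θ h⟩,
    hB.isMinimalFreeResolution hN hI_ne hd ha Θ⟩, fun N hN ι Θ => ?_⟩
  -- For the identity sequence `gammaIdeal` unfolds to `sqIdeal`, so the two statements agree by
  -- definition.
  exact hB.isMinimalFreeResolution (a := fun r => r) hN hI_ne hd (fun _ _ h => h) Θ
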